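/- For a domain (non-empty connected open set) $D\subset\mathbb C^d$ let $K_D$ be its Kobayashi pseudodistance. $D$ is *complete hyperbolic* if $(D,K_D)$ is a complete metric space. A *geodesic segment* of $K_D$ joining $x,y\in D$ is the image of an isometric map $\gamma:[0,L]\to(D,K_D)$ with $\gamma(0)=x$, $\gamma(L)=y$. A complete hyperbolic bounded domain $D$ is *Gromov hyperbolic* if there is $\delta>0$ such that in every geodesic triangle of $(D,K_D)$ each point of a side is at $K_D$-distance at most $\delta$ from the union of the other two sides. Two distinct points $p,q\in\partial D$ (Euclidean boundary) *satisfy the visibility condition for $K_D$* if there are disjoint neighborhoods $V_p$ of $p$ and $V_q$ of $q$ and a compact set $C\subset D$ such that every geodesic segment of $K_D$ joining a point of $D\cap V_p$ to a point of $D\cap V_q$ meets $C$; $D$ is *visible* if this holds for all $p\neq q$ in $\partial D$. A bounded domain $\Omega\subset\mathbb C^d$ is *locally Gromov hyperbolic* if every $p\in\partial\Omega$ has an open neighborhood $U$ such that $\Omega\cap U$ is connected, complete hyperbolic and Gromov hyperbolic. It is *locally visible* if every $p\in\partial\Omega$ has open neighborhoods $V'\subseteq V$ such that $\Omega\cap V$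 is connected and complete hyperbolic, and any two distinct points of $\partial\Omega\cap V'$ satisfy the visibility condition for $K_{\Omega\cap V}$. **Corollary.** Let $\Omega\subset\mathbb C^d$ be a bounded domain that is locally Gromov hyperbolic and locally visible. Then $\Omega$ is complete hyperbolic (that is, $(\Omega,K_\Omega)$ is a complete metric space) and $\Omega$ is visible. -/

import Mathlib

open Filter Topology
open scoped ENNReal ComplexConjugate

noncomputable section

namespace Kobayashi

/-- The Poincaré distance on the unit disc of `ℂ`, normalised to have curvature `-4`. -/
def poincareDist (a b : ℂ) : ℝ :=
  Real.artanh ‖(a - b) / (1 - conj a * b)‖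

variable {d : ℕ}

/-- The Lempert function of `D`: the infimum of the Poincaré distances `poincareDist a b` over all
holomorphic maps `f` from the unit disc to `D` with `f a = x` and `f b = y`. It is `∞` if there is
no such map. -/
def lempert (D : Set (EuclideanSpace ℂ (Fin d))) (x y : EuclideanSpace ℂ (Fin d)) : ℝ≥0∞ :=
  ⨅ (f : ℂ → EuclideanSpace ℂ (Fin d)) (a : ℂ) (b : ℂ)
    (_ : DifferentiableOn ℂ f (Metric.ball 0 1)) (_ : Set.MapsTo f (Metric.ball 0 1) D)
    (_ : a ∈ Metric.ball (0 : ℂ) 1) (_ : b ∈ Metric.ball (0 : ℂ) 1)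
    (_ : f a = x) (_ : f b = y), ENNReal.ofReal (poincareDist a b)

/-- The Kobayashi pseudodistance `K_D` of `D`: the infimum, over all finite chains of analytic discs
in `D` from `x` to `y`, of the sum of the Poincaré lengths of the links. Points in different
connected components of `D` are at distance `∞`. -/
def kobDist (D : Set (EuclideanSpace ℂ (Fin d))) (x y : EuclideanSpace ℂ (Fin d)) : ℝ≥0∞ :=
  ⨅ (n : ℕ) (z : ℕ → EuclideanSpace ℂ (Fin d)) (_ : z 0 = x) (_ : z (n + 1) = y),
    ∑ i ∈ Finset.range (n + 1), lempert D (z i) (z (i + 1))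

/-- `D` is complete hyperbolic: `(D, K_D)` is a metric space (finite and separated; the other axioms
hold for every pseudodistance `K_D`), and every `K_D`-Cauchy sequence in `D` converges
for `K_D` to a point of `D`. -/
def IsCompleteHyperbolic (D : Set (EuclideanSpace ℂ (Fin d))) : Prop :=
  (∀ x ∈ D, ∀ y ∈ D, kobDist D x y ≠ ∞) ∧
  (∀ x ∈ D, ∀ y ∈ D, kobDist D x y = 0 → x = y) ∧
  ∀ u : ℕ → EuclideanSpace ℂ (Fin d), (∀ n, u n ∈ D) →
    (∀ ε : ℝ≥0∞, 0 < ε → ∃ N : ℕ, ∀ m ≥ N, ∀ n ≥ N, kobDist D (u m) (u n) < ε) →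
    ∃ x ∈ D, Tendsto (fun n => kobDist D (u n) x) atTop (𝓝 0)

/-- `S` is (the image of) a geodesic segment of `(D, K_D)` joining `x` and `y`: the image of an
isometric map from a compact interval `[0, L]` to `(D, K_D)` sending `0` to `x` and `L` to `y`. -/
def IsGeodesicSegment (D : Set (EuclideanSpace ℂ (Fin d))) (x y : EuclideanSpace ℂ (Fin d))
    (S : Set (EuclideanSpace ℂ (Fin d))) : Prop :=
  ∃ (L : ℝ) (γ : ℝ → EuclideanSpace ℂ (Fin d)), 0 ≤ L ∧ γ 0 = x ∧ γ L = y ∧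
    (∀ t ∈ Set.Icc 0 L, γ t ∈ D) ∧
    (∀ s ∈ Set.Icc 0 L, ∀ t ∈ Set.Icc 0 L, kobDist D (γ s) (γ t) = ENNReal.ofReal |s - t|) ∧
    S = γ '' Set.Icc 0 L

/-- `(D, K_D)` is Gromov hyperbolic: for some `δ > 0`, every geodesic triangle is `δ`-thin, i.e.
each point of a side is at distance at most `δ` from the union of the two other sides. (The vertices
may be permuted, so that it is enough to write the condition for one side; the distance to the other
sides, which are compact for `K_D`, is attained.) -/
def IsGromovHyperbolic (D : Set (EuclideanSpace ℂ (Fin d))) : Prop :=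
  ∃ δ : ℝ, 0 < δ ∧
    ∀ (x y z : EuclideanSpace ℂ (Fin d)) (S₁ S₂ S₃ : Set (EuclideanSpace ℂ (Fin d))),
      IsGeodesicSegment D x y S₁ → IsGeodesicSegment D y z S₂ → IsGeodesicSegment D z x S₃ →
      ∀ a ∈ S₁, ∃ b ∈ S₂ ∪ S₃, kobDist D a b ≤ ENNReal.ofReal δ

/-- The couple `(p, q)` has the visibility condition with respect to the geodesics of `K_D`: there
are disjoint neighbourhoods of `p` and of `q` and a compact subset `C` of `D` such that every
geodesic segment of `K_D` joining points of `D` in these neighbourhoods meets `C`. -/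
def HasVisibility (D : Set (EuclideanSpace ℂ (Fin d))) (p q : EuclideanSpace ℂ (Fin d)) : Prop :=
  ∃ P ∈ 𝓝 p, ∃ Q ∈ 𝓝 q, ∃ C ⊆ D, IsCompact C ∧ Disjoint P Q ∧
    ∀ x ∈ D ∩ P, ∀ y ∈ D ∩ Q, ∀ S, IsGeodesicSegment D x y S → (S ∩ C).Nonempty

/-- Every couple of distinct points of the Euclidean boundary has the visibility condition. -/
def IsVisible (Ω : Set (EuclideanSpace ℂ (Fin d))) : Prop :=
  ∀ p ∈ frontier Ω, ∀ q ∈ frontier Ω, p ≠ q → HasVisibility Ω p q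

def IsLocallyGromovHyperbolic (Ω : Set (EuclideanSpace ℂ (Fin d))) : Prop :=
  ∀ p ∈ frontier Ω, ∃ U : Set (EuclideanSpace ℂ (Fin d)), IsOpen U ∧ p ∈ U ∧
    IsConnected (Ω ∩ U) ∧ IsCompleteHyperbolic (Ω ∩ U) ∧ IsGromovHyperbolic (Ω ∩ U)

def IsLocallyVisible (Ω : Set (EuclideanSpace ℂ (Fin d))) : Prop :=
  ∀ p ∈ frontier Ω, ∃ V : Set (EuclideanSpace ℂ (Fin d)), IsOpen V ∧ p ∈ V ∧
    IsConnected (Ω ∩ V) ∧ IsCompleteHyperbolic (Ω ∩ V) ∧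
    ∃ V' : Set (EuclideanSpace ℂ (Fin d)), IsOpen V' ∧ p ∈ V' ∧ V' ⊆ V ∧
      ∀ q₁ ∈ frontier Ω ∩ V', ∀ q₂ ∈ frontier Ω ∩ V', q₁ ≠ q₂ → HasVisibility (Ω ∩ V) q₁ q₂

end Kobayashi

end

namespace Kobayashi

open Metric Set

/-! ### Hyperbolic tangent estimates, normalised analytic discs, axioms of the pseudodistance. -/

section

/-! The proof bounds Gromov products. Near a boundary point put `D = Ω ∩ V`. As `(D, K_D)` is
complete, Hopf–Rinow makes it proper and geodesic, so local visibility bounds the Gromov products,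
based at some `o`, of points of `D` near distinct boundary points. Compactness makes the bound
uniform between a ball and a surrounding shell (`exists_uniform_gromov_product_bound`).

The core is `exists_local_estimates`, which carries this bound from `K_D` to `K_Ω`. By Royden's
localisation (`kobDist_inter_le`), `K_D` exceeds `K_Ω` at small scale by at most a factor `1 / tanh
R`, where `R` is roughly the `K_Ω`-distance to the complement of `V`. A fixed `R` already yields a
multiplicative comparison: `R` grows at least linearly with `K_D(·, o)`. Along an almost-geodesic
chain `K_Ω(·, o)`, hence `K_D(·, o)`, grows linearly away from the link nearest to `o`. The excess
`1 / tanh R - 1 ≤ 1 / R ^ 2` is therefore summable along the chain, and the two distances differ by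
an additive constant up to the exit from a small ball.

Two consequences follow. `K_Ω` blows up at the boundary, which gives completeness. Gromov products
for `K_Ω` of points near a boundary point with points away from it are bounded, which forces
geodesics between distinct boundary points through a fixed compact ball. -/

theorem tanh_add (x y : ℝ) :
    Real.tanh (x + y) = (Real.tanh x + Real.tanh y) / (1 + Real.tanh x * Real.tanh y) := by
  have hx := (Real.cosh_pos x).ne'
  have hy := (Real.cosh_pos y).ne'
  have hxy := (Real.cosh_pos (x + y)).ne'
  have h1 : 1 + Real.tanh x * Real.tanh y = Real.cosh (x + y) / (Real.cosh x * Real.cosh y) := by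
    rw [Real.tanh_eq_sinh_div_cosh, Real.tanh_eq_sinh_div_cosh, Real.cosh_add]; field_simp
  rw [h1, Real.tanh_eq_sinh_div_cosh, Real.tanh_eq_sinh_div_cosh, Real.tanh_eq_sinh_div_cosh,
    Real.sinh_add]
  field_simp

theorem tanh_nonneg {x : ℝ} (hx : 0 ≤ x) : 0 ≤ Real.tanh x := by
  rw [Real.tanh_eq_sinh_div_cosh]
  exact div_nonneg (Real.sinh_nonneg_iff.2 hx) (Real.cosh_pos x).le

theorem tanh_pos {x : ℝ} (hx : 0 < x) : 0 < Real.tanh x := by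
  rw [Real.tanh_eq_sinh_div_cosh]
  exact div_pos (Real.sinh_pos_iff.2 hx) (Real.cosh_pos x)

theorem artanh_le_div {u : ℝ} (h0 : 0 ≤ u) (h1 : u < 1) : Real.artanh u ≤ u / (1 - u) := by
  rw [Real.artanh_eq_half_log ⟨by linarith, h1.le⟩]
  have h : 0 < 1 - u := by linarith
  have := Real.log_le_sub_one_of_pos (x := (1 + u) / (1 - u)) (by positivity)
  have h2 : (1 + u) / (1 - u) - 1 = 2 * (u / (1 - u)) := by field_simp; ring
  linarith

theorem le_artanh {u : ℝ} (h0 : 0 ≤ u) (h1 : u < 1) : u ≤ Real.artanh u := by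
  rw [Real.artanh_eq_half_log ⟨by linarith, h1.le⟩, Real.log_div (by linarith) (by linarith)]
  have := Real.hasSum_log_sub_log_of_abs_lt_one (x := u) (by rwa [abs_of_nonneg h0])
  have h6 := this.summable.le_tsum 0 (fun j _ => by positivity)
  rw [this.tsum_eq] at h6
  norm_num at h6
  linarith

theorem tanh_le_self {x : ℝ} (hx : 0 ≤ x) : Real.tanh x ≤ x := by
  have := le_artanh (tanh_nonneg hx) (Real.tanh_lt_one x)
  rwa [Real.artanh_tanh] at this

/-- Bounds the loss in Royden localisation. Since `1 / tanh R = 1 + 2 / (exp (2R) - 1)`, the excess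
decays exponentially; quadratic decay is enough for summability. -/
theorem one_div_tanh_le {R : ℝ} (hR : 0 < R) : 1 / Real.tanh R ≤ 1 + 1 / R ^ 2 := by
  have h : 1 / Real.tanh R = 1 + 2 / (Real.exp (2 * R) - 1) := by
    have h1 : 1 < Real.exp (2 * R) := Real.one_lt_exp_iff.2 (by linarith)
    have h2 : Real.exp (2 * R) = Real.exp R * Real.exp R := by rw [← Real.exp_add]; ring_nf
    have h3 := Real.exp_pos R
    have h4 : Real.exp R * Real.exp R - 1 ≠ 0 := by rw [← h2]; linarith
    rw [Real.tanh_eq, Real.exp_neg, h2]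
    have h5 : Real.exp R ^ 2 - 1 ≠ 0 := by rw [sq]; exact h4
    field_simp
    ring
  rw [h]
  have h1 := Real.quadratic_le_exp_of_nonneg (x := 2 * R) (by linarith)
  have h2 : 2 / (Real.exp (2 * R) - 1) ≤ 2 / (2 * R ^ 2) :=
    div_le_div_of_nonneg_left (by norm_num) (by positivity) (by nlinarith)
  have h3 : 2 / (2 * R ^ 2) = 1 / R ^ 2 := by field_simp
  linarith

variable {d : ℕ}

/-- The map `f` restricts to an analytic disc in `D`. -/
def IsDisc (D : Set (EuclideanSpace ℂ (Fin d))) (f : ℂ → EuclideanSpace ℂ (Fin d)) : Prop :=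
  DifferentiableOn ℂ f (ball 0 1) ∧ MapsTo f (ball 0 1) D

theorem one_add_conj_mul_ne_zero {a w : ℂ} (ha : ‖a‖ < 1) (hw : ‖w‖ < 1) :
    1 + conj a * w ≠ 0 := by
  intro h
  have h1 : conj a * w = -1 := by linear_combination h
  have h2 : ‖a‖ * ‖w‖ = 1 := by
    have := congrArg norm h1
    simpa using this
  nlinarith [norm_nonneg a, norm_nonneg w]

theorem norm_mobius_lt_one {a w : ℂ} (ha : ‖a‖ < 1) (hw : ‖w‖ < 1) :
    ‖(w + a) / (1 + conj a * w)‖ < 1 := by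
  rw [norm_div, div_lt_one (norm_pos_iff.2 (one_add_conj_mul_ne_zero ha hw))]
  have key : ‖1 + conj a * w‖ ^ 2 - ‖w + a‖ ^ 2 = (1 - ‖a‖ ^ 2) * (1 - ‖w‖ ^ 2) := by
    simp only [← Complex.normSq_eq_norm_sq, Complex.normSq_apply]
    simp
    ring
  have h1 : 0 < 1 - ‖a‖ ^ 2 := by nlinarith [norm_nonneg a]
  have h2 : 0 < 1 - ‖w‖ ^ 2 := by nlinarith [norm_nonneg w]
  have h3 := mul_pos h1 h2
  exact lt_of_pow_lt_pow_left₀ 2 (norm_nonneg _) (by linarith)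

variable {D : Set (EuclideanSpace ℂ (Fin d))} {f : ℂ → EuclideanSpace ℂ (Fin d)}

theorem IsDisc.comp_mobius (hf : IsDisc D f) {a u : ℂ} (ha : ‖a‖ < 1) (hu : ‖u‖ = 1) :
    IsDisc D (fun z => f ((u * z + a) / (1 + conj a * (u * z)))) := by
  have hm : ∀ z ∈ ball (0 : ℂ) 1, ‖u * z‖ < 1 := fun z hz => by
    simpa [hu] using hz
  have hmaps : MapsTo (fun z => (u * z + a) / (1 + conj a * (u * z))) (ball (0 : ℂ) 1)
      (ball 0 1) := fun z hz => by
    rw [mem_ball_zero_iff]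
    exact norm_mobius_lt_one ha (hm z hz)
  refine ⟨hf.1.comp ?_ hmaps, hf.2.comp hmaps⟩
  exact DifferentiableOn.div (by fun_prop) (by fun_prop)
    fun z hz => one_add_conj_mul_ne_zero ha (hm z hz)

/-- A Möbius map moves `a` to the origin and a rotation puts the image of `b` on the nonnegative
real axis. -/
theorem IsDisc.exists_recenter (hf : IsDisc D f) {a b : ℂ} (ha : ‖a‖ < 1) (hb : ‖b‖ < 1) :
    ‖(a - b) / (1 - conj a * b)‖ < 1 ∧
      ∃ g, IsDisc D g ∧ g 0 = f a ∧ g (‖(a - b) / (1 - conj a * b)‖ : ℝ) = f b := by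
  set w : ℂ := (b - a) / (1 - conj a * b) with hw
  have hden : 1 - conj a * b ≠ 0 := by
    have := one_add_conj_mul_ne_zero (a := -a) (by simpa using ha) hb
    simpa [sub_eq_add_neg] using this
  have hwn : ‖(a - b) / (1 - conj a * b)‖ = ‖w‖ := by
    rw [hw, norm_div, norm_div, norm_sub_rev]
  have hw1 : ‖w‖ < 1 := by
    have := norm_mobius_lt_one (a := -a) (by simpa using ha) hb
    simpa [sub_eq_add_neg, hw] using this
  have hden2 := one_add_conj_mul_ne_zero ha hw1
  have hb' : (w + a) / (1 + conj a * w) = b := by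
    rw [div_eq_iff hden2]
    have : w * (1 - conj a * b) = b - a := div_mul_cancel₀ _ hden
    linear_combination this
  rw [hwn]
  refine ⟨hw1, ?_⟩
  obtain ⟨u, hu, huw⟩ : ∃ u : ℂ, ‖u‖ = 1 ∧ u * (‖w‖ : ℝ) = w := by
    by_cases h : w = 0
    · exact ⟨1, by simp, by simp [h]⟩
    · have h' : (‖w‖ : ℂ) ≠ 0 := by exact_mod_cast norm_ne_zero_iff.2 h
      exact ⟨w / (‖w‖ : ℝ), by simp [h], div_mul_cancel₀ _ h'⟩
  refine ⟨_, hf.comp_mobius ha hu, by simp, ?_⟩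
  simp only [huw, hb']

/-- `tanh` parametrises the real diameter by Poincaré arc length, so by the addition formula a
hyperbolic translation acts as a shift of the parameter. -/
theorem IsDisc.exists_shift (hf : IsDisc D f) (s : ℝ) :
    ∃ g, IsDisc D g ∧ ∀ h : ℝ, g (Real.tanh h : ℝ) = f (Real.tanh (s + h) : ℝ) := by
  have ha : ‖((Real.tanh s : ℝ) : ℂ)‖ < 1 := by
    rw [Complex.norm_real, Real.norm_eq_abs]; exact Real.abs_tanh_lt_one s
  refine ⟨_, hf.comp_mobius ha (u := 1) (by simp), fun h => ?_⟩
  rw [tanh_add]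
  congr 1
  push_cast
  rw [← Complex.ofReal_tanh s, Complex.conj_ofReal]
  ring_nf

theorem tanh_mem_ball (s : ℝ) : ((Real.tanh s : ℝ) : ℂ) ∈ ball (0 : ℂ) 1 := by
  rw [mem_ball_zero_iff, Complex.norm_real, Real.norm_eq_abs]; exact Real.abs_tanh_lt_one s

theorem lempert_le (hf : IsDisc D f) {a b : ℂ} (ha : a ∈ ball (0 : ℂ) 1)
    (hb : b ∈ ball (0 : ℂ) 1) : lempert D (f a) (f b) ≤ ENNReal.ofReal (poincareDist a b) := by
  unfold lempert
  exact iInf_le_of_le f <| iInf_le_of_le a <| iInf_le_of_le b <| iInf_le_of_le hf.1 <|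
    iInf_le_of_le hf.2 <| iInf_le_of_le ha <| iInf_le_of_le hb <| iInf_le_of_le rfl <|
    iInf_le_of_le rfl le_rfl

theorem lempert_zero_le (hf : IsDisc D f) {b : ℂ} (hb : b ∈ ball (0 : ℂ) 1) :
    lempert D (f 0) (f b) ≤ ENNReal.ofReal (Real.artanh ‖b‖) := by
  simpa [poincareDist] using lempert_le hf (mem_ball_self one_pos) hb

theorem lempert_tanh_le (hf : IsDisc D f) (s t : ℝ) (hst : s ≤ t) :
    lempert D (f (Real.tanh s : ℝ)) (f (Real.tanh t : ℝ)) ≤ ENNReal.ofReal (t - s) := by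
  obtain ⟨g, hg, hgs⟩ := hf.exists_shift s
  have h0 := hgs 0
  have h1 := hgs (t - s)
  have h2 := lempert_zero_le hg (tanh_mem_ball (t - s))
  rw [Complex.norm_real, Real.norm_eq_abs, abs_of_nonneg (tanh_nonneg (by linarith)),
    Real.artanh_tanh] at h2
  simp only [Real.tanh_zero, Complex.ofReal_zero, add_zero, add_sub_cancel] at h0 h1
  rwa [h0, h1] at h2

theorem exists_disc_of_lempert_lt {x y : EuclideanSpace ℂ (Fin d)} {c : ℝ≥0∞}
    (h : lempert D x y < c) : ∃ f, ∃ l : ℝ, IsDisc D f ∧ 0 ≤ l ∧ ENNReal.ofReal l < c ∧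
      f 0 = x ∧ f (Real.tanh l : ℝ) = y := by
  unfold lempert at h
  simp only [iInf_lt_iff] at h
  obtain ⟨f, a, b, h1, h2, ha, hb, rfl, rfl, h⟩ := h
  obtain ⟨hlt, g, hg, hg0, hg1⟩ :=
    IsDisc.exists_recenter ⟨h1, h2⟩ (mem_ball_zero_iff.1 ha) (mem_ball_zero_iff.1 hb)
  refine ⟨g, poincareDist a b, hg, Real.artanh_nonneg (norm_nonneg _), h, hg0, ?_⟩
  rw [← hg1, poincareDist, Real.tanh_artanh ⟨by linarith [norm_nonneg ((a - b) / (1 - conj a * b))],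
    hlt⟩]

theorem lempert_comm (x y : EuclideanSpace ℂ (Fin d)) : lempert D x y = lempert D y x := by
  have key : ∀ x y, lempert D x y ≤ lempert D y x := fun x y => by
    refine le_of_forall_gt fun c hc => ?_
    obtain ⟨f, l, hf, hl, hlc, rfl, rfl⟩ := exists_disc_of_lempert_lt hc
    refine lt_of_le_of_lt ?_ hlc
    have := lempert_le hf (tanh_mem_ball l) (mem_ball_self one_pos)
    simpa [poincareDist, abs_of_nonneg (tanh_nonneg hl), Real.artanh_tanh, -Complex.ofReal_tanh]
      using this
  exact le_antisymm (key x y) (key y x)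

theorem lempert_mono {D' : Set (EuclideanSpace ℂ (Fin d))} (h : D ⊆ D')
    (x y : EuclideanSpace ℂ (Fin d)) : lempert D' x y ≤ lempert D x y := by
  refine le_of_forall_gt fun c hc => ?_
  obtain ⟨f, l, hf, hl, hlc, rfl, rfl⟩ := exists_disc_of_lempert_lt hc
  have hf' : IsDisc D' f := ⟨hf.1, hf.2.mono_right h⟩
  have := lempert_tanh_le hf' 0 l hl
  simp only [Real.tanh_zero, Complex.ofReal_zero, sub_zero] at this
  exact this.trans_lt hlc

theorem kobDist_le_sum (n : ℕ) (z : ℕ → EuclideanSpace ℂ (Fin d)) :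
    kobDist D (z 0) (z (n + 1)) ≤ ∑ i ∈ Finset.range (n + 1), lempert D (z i) (z (i + 1)) := by
  unfold kobDist
  exact iInf_le_of_le n <| iInf_le_of_le z <| iInf_le_of_le rfl <| iInf_le_of_le rfl le_rfl

theorem exists_chain_of_kobDist_lt {x y : EuclideanSpace ℂ (Fin d)} {c : ℝ≥0∞}
    (h : kobDist D x y < c) : ∃ (n : ℕ) (z : ℕ → EuclideanSpace ℂ (Fin d)), z 0 = x ∧
      z (n + 1) = y ∧ ∑ i ∈ Finset.range (n + 1), lempert D (z i) (z (i + 1)) < c := by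
  unfold kobDist at h
  simp only [iInf_lt_iff] at h
  obtain ⟨n, z, h0, h1, h⟩ := h
  exact ⟨n, z, h0, h1, h⟩

theorem kobDist_le_lempert (x y : EuclideanSpace ℂ (Fin d)) :
    kobDist D x y ≤ lempert D x y := by
  have := kobDist_le_sum (D := D) 0 (fun i => if i = 0 then x else y)
  simpa using this

theorem kobDist_comm_le (x y : EuclideanSpace ℂ (Fin d)) :
    kobDist D x y ≤ kobDist D y x := by
  refine le_of_forall_gt fun c hc => ?_
  obtain ⟨n, z, rfl, rfl, h⟩ := exists_chain_of_kobDist_lt hc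
  refine lt_of_le_of_lt ?_ h
  have := kobDist_le_sum (D := D) n (fun i => z (n + 1 - i))
  simp only [Nat.sub_zero, Nat.sub_self] at this
  refine this.trans_eq ?_
  rw [← Finset.sum_range_reflect]
  refine Finset.sum_congr rfl fun i hi => ?_
  rw [Finset.mem_range] at hi
  rw [lempert_comm]
  congr 2 <;> omega

theorem kobDist_comm (x y : EuclideanSpace ℂ (Fin d)) : kobDist D x y = kobDist D y x :=
  le_antisymm (kobDist_comm_le x y) (kobDist_comm_le y x)

theorem kobDist_triangle (x y z : EuclideanSpace ℂ (Fin d)) :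
    kobDist D x z ≤ kobDist D x y + kobDist D y z := by
  refine le_of_forall_gt fun c hc => ?_
  obtain ⟨c₁, h₁, c₂, h₂, hcc⟩ := ENNReal.exists_add_lt_of_add_lt hc
  obtain ⟨n, u, rfl, rfl, hu⟩ := exists_chain_of_kobDist_lt h₁
  obtain ⟨m, v, hv, rfl, hv'⟩ := exists_chain_of_kobDist_lt h₂
  have := kobDist_le_sum (D := D) (n + 1 + m) (fun i => if i ≤ n + 1 then u i else v (i - (n + 1)))
  simp only [Nat.zero_le, if_true, show ¬ (n + 1 + m + 1 ≤ n + 1) by omega, if_false,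
    show n + 1 + m + 1 - (n + 1) = m + 1 by omega] at this
  refine (this.trans ?_).trans_lt ((ENNReal.add_lt_add hu hv').trans hcc)
  rw [show n + 1 + m + 1 = (n + 1) + (m + 1) by ring, Finset.sum_range_add]
  refine add_le_add (Finset.sum_le_sum fun i hi => ?_) (Finset.sum_le_sum fun i hi => ?_)
  · rw [Finset.mem_range] at hi
    rw [if_pos (by omega), if_pos (by omega)]
  · rcases Nat.eq_zero_or_pos i with rfl | h
    · simp [hv]
    · rw [if_neg (by omega), if_neg (by omega)]
      apply le_of_eq; congr 2 <;> omega

theorem kobDist_mono {D' : Set (EuclideanSpace ℂ (Fin d))} (h : D ⊆ D')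
    (x y : EuclideanSpace ℂ (Fin d)) : kobDist D' x y ≤ kobDist D x y := by
  refine le_of_forall_gt fun c hc => ?_
  obtain ⟨n, z, rfl, rfl, hz⟩ := exists_chain_of_kobDist_lt hc
  exact ((kobDist_le_sum n z).trans (Finset.sum_le_sum fun i _ => lempert_mono h _ _)).trans_lt hz

theorem kobDist_self {x : EuclideanSpace ℂ (Fin d)} (hx : x ∈ D) : kobDist D x x = 0 := by
  have hf : IsDisc D (fun _ => x) := ⟨by fun_prop, fun _ _ => hx⟩
  have := (kobDist_le_lempert (D := D) x x).trans (lempert_tanh_le hf 0 0 le_rfl)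
  simpa using this

theorem mem_of_lempert_ne_top {x y : EuclideanSpace ℂ (Fin d)} (h : lempert D x y ≠ ∞) :
    x ∈ D ∧ y ∈ D := by
  obtain ⟨f, l, hf, -, -, rfl, rfl⟩ := exists_disc_of_lempert_lt (lt_top_iff_ne_top.2 h)
  exact ⟨hf.2 (mem_ball_self one_pos), hf.2 (tanh_mem_ball l)⟩

end

/-! ### Comparison with the Euclidean metric; finiteness and the length-space property. -/

section

variable {d : ℕ} {D : Set (EuclideanSpace ℂ (Fin d))} {f : ℂ → EuclideanSpace ℂ (Fin d)}

/-- Schwarz lemma for a disc with values in the ball of radius `2 * M` about its centre, with `tanh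
l ≤ l`. -/
theorem norm_sub_le_lempert {M : ℝ} (hM : 0 < M) (hD : D ⊆ ball 0 M)
    (x y : EuclideanSpace ℂ (Fin d)) :
    ENNReal.ofReal (‖x - y‖ / (2 * M)) ≤ lempert D x y := by
  refine le_of_forall_gt fun c hc => ?_
  obtain ⟨f, l, hf, hl, hlc, rfl, rfl⟩ := exists_disc_of_lempert_lt hc
  refine (ENNReal.ofReal_le_ofReal ?_).trans_lt hlc
  have h0 := mem_ball_zero_iff.1 (hD (hf.2 (mem_ball_self one_pos)))
  have hmaps : MapsTo f (ball 0 1) (closedBall (f 0) (2 * M)) := fun z hz => by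
    have h1 := mem_ball_zero_iff.1 (hD (hf.2 hz))
    rw [mem_closedBall, dist_eq_norm]
    linarith [norm_sub_le (f z) (f 0)]
  have := Complex.dist_le_div_mul_dist_of_mapsTo_ball hf.1 hmaps (tanh_mem_ball l)
  rw [dist_zero_right, Complex.norm_real, Real.norm_eq_abs, abs_of_nonneg (tanh_nonneg hl),
    dist_comm, dist_eq_norm, div_one] at this
  rw [div_le_iff₀ (by positivity)]
  nlinarith [tanh_le_self hl]

theorem norm_sub_le_kobDist {M : ℝ} (hM : 0 < M) (hD : D ⊆ ball 0 M)
    (x y : EuclideanSpace ℂ (Fin d)) :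
    ENNReal.ofReal (‖x - y‖ / (2 * M)) ≤ kobDist D x y := by
  refine le_of_forall_gt fun c hc => ?_
  obtain ⟨n, z, rfl, rfl, hz⟩ := exists_chain_of_kobDist_lt hc
  refine lt_of_le_of_lt ?_ hz
  refine le_trans ?_ (Finset.sum_le_sum fun i _ => norm_sub_le_lempert hM hD _ _)
  rw [← ENNReal.ofReal_sum_of_nonneg fun i _ => by positivity, ← Finset.sum_div]
  refine ENNReal.ofReal_le_ofReal (div_le_div_of_nonneg_right ?_ (by positivity))
  simp only [← dist_eq_norm]
  exact dist_le_range_sum_dist z (n + 1)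

/-- Uses the affine disc of radius `r` centred at `x` in the direction of `y`. -/
theorem kobDist_le_of_ball_subset {x y : EuclideanSpace ℂ (Fin d)} {r : ℝ} (hr : ball x r ⊆ D)
    (hy : y ∈ ball x r) : kobDist D x y ≤ ENNReal.ofReal (Real.artanh (‖y - x‖ / r)) := by
  have hr0 : 0 < r := pos_of_mem_ball hy
  rw [mem_ball, dist_eq_norm] at hy
  rcases eq_or_ne y x with rfl | hne
  · rw [kobDist_self (hr (mem_ball_self hr0))]; exact zero_le
  have hn : 0 < ‖y - x‖ := norm_pos_iff.2 (sub_ne_zero.2 hne)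
  set g : ℂ → EuclideanSpace ℂ (Fin d) := fun ζ => x + (ζ * (r / ‖y - x‖ : ℝ)) • (y - x) with hg
  have hdisc : IsDisc D g := by
    refine ⟨by fun_prop, fun z hz => hr ?_⟩
    rw [mem_ball_zero_iff] at hz
    rw [mem_ball, dist_eq_norm, hg]
    simp only [add_sub_cancel_left, norm_smul, norm_mul, Complex.norm_real, Real.norm_eq_abs,
      abs_of_pos (div_pos hr0 hn)]
    rw [mul_assoc, div_mul_cancel₀ _ hn.ne']
    nlinarith
  have hlt : ‖y - x‖ / r < 1 := by rwa [div_lt_one hr0]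
  have hmem : ((‖y - x‖ / r : ℝ) : ℂ) ∈ ball (0 : ℂ) 1 := by
    rw [mem_ball_zero_iff, Complex.norm_real, Real.norm_eq_abs, abs_of_pos (by positivity)]
    exact hlt
  have h1 : g 0 = x := by simp [hg]
  have h2 : g (‖y - x‖ / r : ℝ) = y := by
    simp only [hg]
    rw [← Complex.ofReal_mul, show ‖y - x‖ / r * (r / ‖y - x‖) = 1 by field_simp]
    simp
  have := (kobDist_le_lempert _ _).trans (lempert_zero_le hdisc hmem)
  rwa [h1, h2, Complex.norm_real, Real.norm_eq_abs, abs_of_pos (by positivity)] at this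

theorem tendsto_kobDist_nhds (hD : IsOpen D) {x : EuclideanSpace ℂ (Fin d)} (hx : x ∈ D) :
    Tendsto (fun y => kobDist D x y) (𝓝 x) (𝓝 0) := by
  obtain ⟨r, hr, hrD⟩ := Metric.isOpen_iff.1 hD x hx
  have h1 : Tendsto (fun y => ENNReal.ofReal (‖y - x‖ / r / (1 - ‖y - x‖ / r))) (𝓝 x) (𝓝 0) := by
    have : ContinuousAt (fun y => ENNReal.ofReal (‖y - x‖ / r / (1 - ‖y - x‖ / r))) x := by
      refine ENNReal.continuous_ofReal.continuousAt.comp ?_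
      exact ContinuousAt.div (by fun_prop) (by fun_prop) (by simp)
    simpa using this.tendsto
  refine tendsto_of_tendsto_of_tendsto_of_le_of_le' tendsto_const_nhds h1
    (Eventually.of_forall fun _ => zero_le) ?_
  filter_upwards [ball_mem_nhds x hr] with y hy
  refine (kobDist_le_of_ball_subset hrD hy).trans (ENNReal.ofReal_le_ofReal ?_)
  rw [mem_ball, dist_eq_norm] at hy
  exact artanh_le_div (by positivity) (by rwa [div_lt_one hr])

/-- Being at finite distance is an equivalence relation on `D` with open classes. -/
theorem kobDist_ne_top (hD : IsOpen D) (hc : IsPreconnected D) {x y : EuclideanSpace ℂ (Fin d)}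
    (hx : x ∈ D) (hy : y ∈ D) : kobDist D x y ≠ ∞ := by
  have hfin : ∀ z ∈ D, ∀ᶠ w in 𝓝 z, kobDist D z w ≠ ∞ := fun z hz => by
    filter_upwards [(tendsto_kobDist_nhds hD hz).eventually_lt_const ENNReal.zero_lt_top] with w hw
    exact hw.ne
  refine hc.induction₂ (fun a b => kobDist D a b ≠ ∞)
    (fun z hz => nhdsWithin_le_nhds (hfin z hz)) ?_ ?_ hx hy
  · intro a b c _ _ _ hab hbc
    exact ((kobDist_triangle a b c).trans_lt
      (ENNReal.add_lt_top.2 ⟨hab.lt_top, hbc.lt_top⟩)).ne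
  · intro a b _ _ h
    rwa [kobDist_comm]

/-- `(D, K_D)` is a length space. -/
theorem exists_between_of_kobDist_lt {x y : EuclideanSpace ℂ (Fin d)} {a b : ℝ≥0∞}
    (ha : 0 < a) (hb : 0 < b) (h : kobDist D x y < a + b) :
    ∃ z ∈ D, kobDist D x z < a ∧ kobDist D z y < b := by
  have link : ∀ (x y : EuclideanSpace ℂ (Fin d)) (a b : ℝ≥0∞), 0 < a → 0 < b →
      lempert D x y < a + b → ∃ z ∈ D, kobDist D x z < a ∧ kobDist D z y < b := by
    intro x y a b ha hb h
    obtain ⟨f, l, hf, hl, hlab, rfl, rfl⟩ := exists_disc_of_lempert_lt h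
    -- The diameter of the disc is cut in the proportion `a : b`.
    obtain ⟨s, hs0, hsl, hsa, hsb⟩ : ∃ s : ℝ, 0 ≤ s ∧ s ≤ l ∧ ENNReal.ofReal s < a ∧
        ENNReal.ofReal (l - s) < b := by
      rcases eq_or_ne a ∞ with rfl | hat
      · exact ⟨l, hl, le_rfl, ENNReal.ofReal_lt_top, by simpa using hb⟩
      rcases eq_or_ne b ∞ with rfl | hbt
      · exact ⟨0, le_rfl, hl, by simpa using ha, ENNReal.ofReal_lt_top⟩
      lift a to NNReal using hat
      lift b to NNReal using hbt
      rw [← ENNReal.coe_add, ENNReal.ofReal_lt_coe_iff hl, NNReal.coe_add] at hlab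
      have ha' : (0 : ℝ) < a := by exact_mod_cast ha
      have hb' : (0 : ℝ) < b := by exact_mod_cast hb
      have hab : l / (a + b) < 1 := by rwa [div_lt_one (by positivity)]
      refine ⟨l / (a + b) * a, by positivity, ?_, ?_, ?_⟩
      · rw [div_mul_eq_mul_div, div_le_iff₀ (by positivity)]
        nlinarith
      · rw [ENNReal.ofReal_lt_coe_iff (by positivity)]
        nlinarith
      · have : l - l / (a + b) * a = l / (a + b) * b := by field_simp; ring
        rw [this, ENNReal.ofReal_lt_coe_iff (by positivity)]
        nlinarith
    refine ⟨f (Real.tanh s : ℝ), hf.2 (tanh_mem_ball s), ?_, ?_⟩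
    · have := (kobDist_le_lempert _ _).trans (lempert_tanh_le hf 0 s hs0)
      simp only [Real.tanh_zero, Complex.ofReal_zero, sub_zero] at this
      exact this.trans_lt hsa
    · exact ((kobDist_le_lempert _ _).trans (lempert_tanh_le hf s l hsl)).trans_lt hsb
  obtain ⟨n, z, rfl, rfl, hz⟩ := exists_chain_of_kobDist_lt h
  clear h
  induction n generalizing z a with
  | zero =>
    rw [zero_add, Finset.sum_range_one] at hz
    exact link _ _ _ _ ha hb hz
  | succ n ih =>
    rw [Finset.sum_range_succ'] at hz
    set S := ∑ i ∈ Finset.range (n + 1), lempert D (z (i + 1)) (z (i + 1 + 1)) with hS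
    have hrest : kobDist D (z 1) (z (n + 1 + 1)) ≤ S := kobDist_le_sum n (fun i => z (i + 1))
    -- The cut lies beyond the first link if that link is shorter than `a`, and otherwise can be
    -- taken on it.
    rcases lt_or_ge (lempert D (z 0) (z 1)) a with hla | hla
    · have h1 : S < (a - lempert D (z 0) (z 1)) + b := by
        have hfin : lempert D (z 0) (z 1) ≠ ∞ := hla.ne_top
        refine (ENNReal.add_lt_add_iff_right hfin).1 (hz.trans_eq ?_)
        rw [add_right_comm, tsub_add_cancel_of_le hla.le]
      obtain ⟨w, hw, hw1, hw2⟩ := ih (tsub_pos_of_lt hla) (fun i => z (i + 1)) h1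
      refine ⟨w, hw, ?_, hw2⟩
      refine (kobDist_triangle _ (z 1) _).trans_lt ?_
      rw [← add_tsub_cancel_of_le hla.le]
      refine ENNReal.add_lt_add_of_le_of_lt ?_ (kobDist_le_lempert _ _) hw1
      exact ((kobDist_le_lempert _ _).trans_lt hla).ne_top
    · have hSb : S < b := by
        refine lt_of_not_ge fun hbS => hz.not_ge ?_
        rw [add_comm a b]
        exact add_le_add hbS hla
      have h1 : lempert D (z 0) (z 1) < a + (b - S) := by
        refine (ENNReal.add_lt_add_iff_right hSb.ne_top).1 ?_
        rw [add_assoc, tsub_add_cancel_of_le hSb.le, add_comm]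
        exact hz
      obtain ⟨w, hw, hw1, hw2⟩ := link _ _ _ _ ha (tsub_pos_of_lt hSb) h1
      refine ⟨w, hw, hw1, (kobDist_triangle _ (z 1) _).trans_lt ?_⟩
      rw [← tsub_add_cancel_of_le hSb.le]
      exact ENNReal.add_lt_add_of_lt_of_le (hrest.trans_lt hSb).ne_top hw2 hrest

end

/-! ### Royden's localisation. -/

section

variable {d : ℕ} {Ω V : Set (EuclideanSpace ℂ (Fin d))} {f : ℂ → EuclideanSpace ℂ (Fin d)}

/-- The image of the disc of radius `tanh R` stays at `K_Ω`-distance less than `R` from the centre,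
so it cannot leave `V`; rescaling makes it a unit disc. -/
theorem IsDisc.restrict (hf : IsDisc Ω f) {R : ℝ} (hR : 0 < R)
    (h : ∀ w ∈ Ω, w ∉ V → ENNReal.ofReal R ≤ kobDist Ω (f 0) w) :
    IsDisc (Ω ∩ V) (fun ζ => f ((Real.tanh R : ℝ) * ζ)) := by
  have hτ := tanh_pos hR
  have hn : ∀ ζ ∈ ball (0 : ℂ) 1, ‖((Real.tanh R : ℝ) : ℂ) * ζ‖ < Real.tanh R := fun ζ hζ => by
    rw [mem_ball_zero_iff] at hζ
    rw [norm_mul, Complex.norm_real, Real.norm_eq_abs, abs_of_pos hτ]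
    nlinarith
  have hb : MapsTo (fun ζ => ((Real.tanh R : ℝ) : ℂ) * ζ) (ball 0 1) (ball 0 1) := fun ζ hζ =>
    mem_ball_zero_iff.2 ((hn ζ hζ).trans (Real.tanh_lt_one R))
  refine ⟨hf.1.comp (by fun_prop) hb, fun ζ hζ => ⟨hf.2 (hb hζ), ?_⟩⟩
  by_contra hV
  have h1 := (h _ (hf.2 (hb hζ)) hV).trans
    ((kobDist_le_lempert _ _).trans (lempert_zero_le hf (hb hζ)))
  have h2 : Real.artanh ‖((Real.tanh R : ℝ) : ℂ) * ζ‖ < R := by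
    conv_rhs => rw [← Real.artanh_tanh R]
    exact Real.artanh_lt_artanh (by linarith [norm_nonneg (((Real.tanh R : ℝ) : ℂ) * ζ)])
      (Real.tanh_lt_one R) (hn ζ hζ)
  exact h1.not_gt ((ENNReal.ofReal_lt_ofReal_iff hR).2 h2)

/-- Royden's localisation along an analytic disc. -/
theorem kobDist_inter_disc_le (hf : IsDisc Ω f) {l R : ℝ} (hl : 0 ≤ l) (hR : 0 < R)
    (h : ∀ s ∈ Icc 0 l, ∀ w ∈ Ω, w ∉ V →
      ENNReal.ofReal R ≤ kobDist Ω (f (Real.tanh s : ℝ)) w) :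
    kobDist (Ω ∩ V) (f 0) (f (Real.tanh l : ℝ)) ≤ ENNReal.ofReal (l / Real.tanh R) := by
  have hτ := tanh_pos hR
  set τ := Real.tanh R with hτdef
  have step : ∀ s ∈ Icc 0 l, ∀ t, 0 ≤ t → t / τ < 1 →
      kobDist (Ω ∩ V) (f (Real.tanh s : ℝ)) (f (Real.tanh (s + t) : ℝ)) ≤
        ENNReal.ofReal (t / τ / (1 - t / τ)) := by
    intro s hs t ht htτ
    obtain ⟨g, hg, hgs⟩ := hf.exists_shift s
    have hg0 : g 0 = f (Real.tanh s : ℝ) := by simpa using hgs 0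
    have hdisc := hg.restrict hR (V := V) (by rw [hg0]; exact h s hs)
    have hu : Real.tanh t / τ ≤ t / τ := div_le_div_of_nonneg_right (tanh_le_self ht) hτ.le
    have hu0 : 0 ≤ Real.tanh t / τ := div_nonneg (tanh_nonneg ht) hτ.le
    have hmem : ((Real.tanh t / τ : ℝ) : ℂ) ∈ ball (0 : ℂ) 1 := by
      rw [mem_ball_zero_iff, Complex.norm_real, Real.norm_eq_abs, abs_of_nonneg hu0]
      exact hu.trans_lt htτ
    have h1 := (kobDist_le_lempert _ _).trans (lempert_zero_le hdisc hmem)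
    simp only [mul_zero, hg0, ← Complex.ofReal_mul, ← hτdef] at h1
    rw [mul_div_cancel₀ _ hτ.ne', hgs, Complex.norm_real, Real.norm_eq_abs, abs_of_nonneg hu0] at h1
    refine h1.trans (ENNReal.ofReal_le_ofReal ((artanh_le_div hu0 (hu.trans_lt htτ)).trans ?_))
    exact div_le_div₀ (hu0.trans hu) hu (by linarith) (by linarith)
  have hmem0 : f 0 ∈ Ω ∩ V := by
    have := (hf.restrict hR (V := V) (by simpa using h 0 ⟨le_rfl, hl⟩)).2 (mem_ball_self one_pos)
    simpa using this
  -- The segment is cut into `N` equal pieces; the nonlinear error factor `1 / (1 - l / N / τ)`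
  -- tends to `1` as `N` grows.
  have bound : ∀ N : ℕ, 0 < N → l / N / τ < 1 → kobDist (Ω ∩ V) (f 0) (f (Real.tanh l : ℝ)) ≤
      ENNReal.ofReal (l / τ / (1 - l / N / τ)) := by
    intro N hN hlN
    have hN' : (0 : ℝ) < N := by exact_mod_cast hN
    have hpos : 0 < 1 - l / N / τ := by linarith
    have hind : ∀ i : ℕ, i ≤ N → kobDist (Ω ∩ V) (f 0) (f (Real.tanh (i * (l / N)) : ℝ)) ≤
        ENNReal.ofReal (i * (l / N / τ / (1 - l / N / τ))) := by
      intro i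
      induction i with
      | zero => intro _; simp [kobDist_self hmem0]
      | succ i ih =>
        intro hi
        have hs : (i : ℝ) * (l / N) ∈ Icc 0 l := by
          refine ⟨by positivity, ?_⟩
          have : (i : ℝ) ≤ N := by exact_mod_cast (by omega : i ≤ N)
          calc (i : ℝ) * (l / N) ≤ N * (l / N) := by gcongr
            _ = l := by field_simp
        have h2 := step _ hs (l / N) (by positivity) hlN
        refine (kobDist_triangle _ (f (Real.tanh (i * (l / N)) : ℝ)) _).trans ?_
        rw [show ((i + 1 : ℕ) : ℝ) * (l / N) = i * (l / N) + l / N by push_cast; ring]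
        refine (add_le_add (ih (by omega)) h2).trans_eq ?_
        rw [← ENNReal.ofReal_add (by positivity) (by positivity)]
        congr 1
        push_cast
        ring
    have := hind N le_rfl
    rw [mul_div_cancel₀ _ hN'.ne'] at this
    refine this.trans_eq ?_
    congr 1
    field_simp
  have hlim : Tendsto (fun N : ℕ => l / N / τ) atTop (𝓝 0) := by
    simpa using (tendsto_const_div_atTop_nhds_zero_nat l).div_const τ
  have hlim2 : Tendsto (fun N : ℕ => ENNReal.ofReal (l / τ / (1 - l / N / τ))) atTop
      (𝓝 (ENNReal.ofReal (l / τ))) := by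
    refine ENNReal.tendsto_ofReal ?_
    have : Tendsto (fun N : ℕ => l / τ / (1 - l / N / τ)) atTop (𝓝 (l / τ / (1 - 0))) :=
      Tendsto.div tendsto_const_nhds (hlim.const_sub 1) (by norm_num)
    simpa using this
  refine ge_of_tendsto hlim2 ?_
  filter_upwards [hlim.eventually_lt_const one_pos, eventually_gt_atTop 0] with N h1 h2
  exact bound N h2 h1

/-- Royden's localisation of the Kobayashi distance. -/
theorem kobDist_inter_le {x y : EuclideanSpace ℂ (Fin d)} {R s : ℝ} (hsR : s < R)
    (hR : ∀ w ∈ Ω, w ∉ V → ENNReal.ofReal R ≤ kobDist Ω x w)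
    (h : kobDist Ω x y < ENNReal.ofReal s) :
    kobDist (Ω ∩ V) x y ≤ ENNReal.ofReal (s / Real.tanh (R - s)) := by
  have hs0 : 0 < s := ENNReal.ofReal_pos.1 ((zero_le).trans_lt h)
  have hτ := tanh_pos (sub_pos.2 hsR)
  set τ := Real.tanh (R - s) with hτdef
  have hfar : ∀ u, kobDist Ω x u < ENNReal.ofReal s → ∀ w ∈ Ω, w ∉ V →
      ENNReal.ofReal (R - s) ≤ kobDist Ω u w := by
    intro u hu w hw hwV
    rw [ENNReal.ofReal_sub _ hs0.le, tsub_le_iff_left]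
    exact (hR w hw hwV).trans ((kobDist_triangle x u w).trans (by gcongr))
  -- The length budget `s` keeps every point of the connecting disc segment within `s` of `x`, hence
  -- at distance at least `R - s` from the outside of `V`.
  have link : ∀ u v, kobDist Ω x u + lempert Ω u v < ENNReal.ofReal s →
      kobDist (Ω ∩ V) u v ≤ ENNReal.ofReal τ⁻¹ * lempert Ω u v := by
    intro u v huv
    have hc0 : ENNReal.ofReal τ⁻¹ ≠ 0 := (ENNReal.ofReal_pos.2 (inv_pos.2 hτ)).ne'
    have hc1 : ENNReal.ofReal τ⁻¹ ≠ ∞ := ENNReal.ofReal_ne_top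
    rw [mul_comm, ← ENNReal.div_le_iff hc0 hc1]
    refine le_of_forall_gt_imp_ge_of_dense fun L hL => ?_
    rw [ENNReal.div_le_iff hc0 hc1, mul_comm]
    have hxu : kobDist Ω x u < ENNReal.ofReal s := lt_of_le_of_lt le_self_add huv
    have h1 : lempert Ω u v < min L (ENNReal.ofReal s - kobDist Ω x u) :=
      lt_min hL (by rw [lt_tsub_iff_left]; exact huv)
    obtain ⟨f, l, hf, hl, hlL, rfl, rfl⟩ := exists_disc_of_lempert_lt h1
    have h2 := kobDist_inter_disc_le hf hl (sub_pos.2 hsR) (V := V) fun t ht => by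
      refine hfar _ ((kobDist_triangle _ (f 0) _).trans_lt ?_)
      have h3 := (kobDist_le_lempert _ _).trans (lempert_tanh_le hf 0 t ht.1)
      simp only [Real.tanh_zero, Complex.ofReal_zero, sub_zero] at h3
      have h4 := lt_tsub_iff_left.1 (hlL.trans_le (min_le_right _ _))
      exact lt_of_le_of_lt (by gcongr; exact h3.trans (ENNReal.ofReal_le_ofReal ht.2)) h4
    rw [← hτdef, div_eq_inv_mul, ENNReal.ofReal_mul (inv_pos.2 hτ).le] at h2
    refine h2.trans ?_
    gcongr
    exact hlL.le.trans (min_le_left _ _)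
  have chain : ∀ (n : ℕ) (z : ℕ → EuclideanSpace ℂ (Fin d)),
      kobDist Ω x (z 0) + ∑ i ∈ Finset.range (n + 1), lempert Ω (z i) (z (i + 1)) <
        ENNReal.ofReal s →
      kobDist (Ω ∩ V) (z 0) (z (n + 1)) ≤
        ENNReal.ofReal τ⁻¹ * ∑ i ∈ Finset.range (n + 1), lempert Ω (z i) (z (i + 1)) := by
    intro n z
    induction n with
    | zero => intro hz; simpa using link _ _ (by simpa using hz)
    | succ n ih =>
      intro hz
      rw [Finset.sum_range_succ, ← add_assoc] at hz
      rw [Finset.sum_range_succ, mul_add]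
      refine (kobDist_triangle _ (z (n + 1)) _).trans (add_le_add ?_ ?_)
      · exact ih (lt_of_le_of_lt le_self_add hz)
      · refine link _ _ (lt_of_le_of_lt ?_ hz)
        gcongr
        exact (kobDist_triangle _ (z 0) _).trans (by gcongr; exact kobDist_le_sum n z)
  obtain ⟨n, z, rfl, rfl, hz⟩ := exists_chain_of_kobDist_lt h
  have hmem : z 0 ∈ Ω := by
    refine (mem_of_lempert_ne_top (D := Ω) (y := z 1) fun htop => ?_).1
    rw [Finset.sum_range_succ', zero_add, htop, add_top] at hz
    exact not_top_lt hz
  rw [div_eq_inv_mul, ENNReal.ofReal_mul (inv_pos.2 hτ).le]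
  refine (chain n z (by rwa [kobDist_self hmem, zero_add])).trans ?_
  gcongr

end

/-! ### Hopf–Rinow: complete locally compact length spaces are proper and geodesic. -/

section

section HopfRinow

variable {X : Type*} [MetricSpace X]

/-- One half of the Hopf–Rinow theorem: a complete locally compact length space is proper. -/
theorem properSpace_of_complete_length [CompleteSpace X] [WeaklyLocallyCompactSpace X]
    (hlen : ∀ (x y : X) (a b : ℝ), 0 < a → 0 < b → dist x y < a + b →
      ∃ z, dist x z < a ∧ dist z y < b) : ProperSpace X := by
  refine ⟨fun o r => ?_⟩
  by_contra hr
  set S : Set ℝ := {s | IsCompact (closedBall o s)} with hS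
  have hmono : ∀ s ∈ S, ∀ t ≤ s, t ∈ S := fun s hs t hts =>
    IsCompact.of_isClosed_subset hs isClosed_closedBall (closedBall_subset_closedBall hts)
  have hbdd : BddAbove S := ⟨r, fun s hs => le_of_not_gt fun h => hr (hmono s hs r h.le)⟩
  obtain ⟨K, hK, hKo⟩ := exists_compact_mem_nhds o
  obtain ⟨ε, hε, hεK⟩ := Metric.nhds_basis_closedBall.mem_iff.1 hKo
  have hεS : ε ∈ S := hK.of_isClosed_subset isClosed_closedBall hεK
  set ρ := sSup S with hρ
  have hρ0 : 0 < ρ := hε.trans_le (le_csSup hbdd hεS)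
  have hlt : ∀ s < ρ, s ∈ S := fun s hs => by
    obtain ⟨t, ht, hst⟩ := exists_lt_of_lt_csSup ⟨ε, hεS⟩ hs
    exact hmono t ht s hst.le
  -- Each point of the critical ball is within `2 * δ` of the compact ball of radius `ρ - δ`, whose
  -- finite net is thus also a net for the critical ball.
  have hcomp : IsCompact (closedBall o ρ) := by
    refine isCompact_iff_totallyBounded_isComplete.2 ⟨?_, isClosed_closedBall.isComplete⟩
    rw [Metric.totallyBounded_iff]
    intro η hη
    set δ := min (η / 3) (ρ / 2) with hδ
    have hδ0 : 0 < δ := by positivity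
    have hδη : δ ≤ η / 3 := min_le_left _ _
    have hδρ : δ ≤ ρ / 2 := min_le_right _ _
    obtain ⟨t, ht, htc⟩ := Metric.totallyBounded_iff.1
      (hlt (ρ - δ) (by linarith)).totallyBounded (η / 3) (by positivity)
    refine ⟨t, ht, fun x hx => ?_⟩
    rw [mem_closedBall'] at hx
    obtain ⟨z, hz1, hz2⟩ := hlen o x (ρ - δ) (2 * δ) (by linarith) (by positivity) (by linarith)
    have hz := htc (mem_closedBall'.2 hz1.le)
    rw [mem_iUnion₂] at hz ⊢
    obtain ⟨y, hy, hzy⟩ := hz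
    refine ⟨y, hy, ?_⟩
    rw [mem_ball] at hzy ⊢
    have := dist_triangle x z y
    rw [dist_comm x z] at this
    linarith
  obtain ⟨K', hK', hsub⟩ := exists_compact_superset hcomp
  obtain ⟨δ, hδ, hδK⟩ := hcomp.exists_thickening_subset_open isOpen_interior hsub
  -- A compact neighbourhood of the critical ball contains a slightly larger ball, contradicting the
  -- supremum.
  have hmem : ρ + δ / 2 ∈ S := by
    refine hK'.of_isClosed_subset isClosed_closedBall fun x hx => interior_subset (hδK ?_)
    rw [mem_closedBall'] at hx
    obtain ⟨z, hz1, hz2⟩ := hlen o x ρ δ hρ0 hδ (by linarith)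
    rw [mem_thickening_iff]
    exact ⟨z, mem_closedBall'.2 hz1.le, by rwa [dist_comm]⟩
  have := le_csSup hbdd hmem
  linarith

variable [ProperSpace X]

/-- Minimises the larger of the two excesses over a compact ball. Approximate intermediate points
make the minimum nonpositive, and the triangle inequality then forces both equalities. -/
theorem exists_exact_between
    (hlen : ∀ (x y : X) (a b : ℝ), 0 < a → 0 < b → dist x y < a + b →
      ∃ z, dist x z < a ∧ dist z y < b)
    (x y : X) {a : ℝ} (ha : 0 ≤ a) (hax : a ≤ dist x y) :
    ∃ z, dist x z = a ∧ dist z y = dist x y - a := by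
  obtain ⟨z, hz, hmin⟩ := (isCompact_closedBall x (a + 1)).exists_isMinOn
    ⟨x, mem_closedBall_self (by linarith)⟩
    (f := fun z => max (dist x z - a) (dist z y - (dist x y - a))) (by fun_prop)
  have hle : max (dist x z - a) (dist z y - (dist x y - a)) ≤ 0 := by
    refine le_of_forall_pos_le_add fun ε hε => ?_
    have hε' : 0 < min ε 1 := by positivity
    obtain ⟨w, hw1, hw2⟩ := hlen x y (a + min ε 1) (dist x y - a + min ε 1) (by linarith)
      (by linarith) (by linarith)
    have hw : w ∈ closedBall x (a + 1) := by
      rw [mem_closedBall']; linarith [min_le_right ε 1]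
    refine (hmin hw).trans ?_
    have := min_le_left ε 1
    simp only [sup_le_iff]
    constructor <;> linarith
  rw [max_le_iff] at hle
  have := dist_triangle x z y
  exact ⟨z, by linarith, by linarith⟩

/-- Induction on the largest parameter `a`: an exact intermediate point `z` at distance `a` replaces
`y` as endpoint for the smaller parameters. This is why `y` is quantified after `F`. -/
theorem exists_isometric_on_finset
    (hlen : ∀ (x y : X) (a b : ℝ), 0 < a → 0 < b → dist x y < a + b →
      ∃ z, dist x z < a ∧ dist z y < b)
    (x : X) (F : Finset ℝ) : ∀ y : X,
    (∀ s ∈ F, s ∈ Icc 0 (dist x y)) → ∃ γ : ℝ → X, (∀ t, dist x (γ t) ≤ dist x y) ∧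
      ∀ s ∈ F, dist x (γ s) = s ∧ dist (γ s) y = dist x y - s ∧
        ∀ t ∈ F, dist (γ s) (γ t) = |s - t| := by
  induction F using Finset.induction_on_max with
  | empty => intro y _; exact ⟨fun _ => x, by simp, by simp⟩
  | insert a F ha ih =>
    intro y hF
    have haF := hF a (Finset.mem_insert_self _ _)
    obtain ⟨z, hz1, hz2⟩ := exists_exact_between hlen x y haF.1 haF.2
    obtain ⟨γ, hγ, hγF⟩ := ih z fun s hs =>
      ⟨(hF s (Finset.mem_insert_of_mem hs)).1, by rw [hz1]; exact (ha s hs).le⟩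
    rw [hz1] at hγ hγF
    refine ⟨fun t => if t = a then z else γ t, fun t => ?_, ?_⟩
    · dsimp only
      split_ifs
      · rw [hz1]; exact haF.2
      · exact (hγ t).trans haF.2
    · have hγy : ∀ s ∈ F, dist (γ s) y = dist x y - s := fun s hs => by
        obtain ⟨h1, h2, -⟩ := hγF s hs
        have h3 := dist_triangle (γ s) z y
        have h4 := dist_triangle x (γ s) y
        linarith
      have hne : ∀ s ∈ F, s ≠ a := fun s hs => (ha s hs).ne
      intro s hs
      rw [Finset.mem_insert] at hs
      rcases hs with rfl | hs
      · refine ⟨by simpa using hz1, by simpa using hz2, fun t ht => ?_⟩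
        rw [Finset.mem_insert] at ht
        rcases ht with rfl | ht
        · simp
        · simp only [if_true, if_neg (hne t ht)]
          rw [dist_comm, (hγF t ht).2.1, abs_of_pos (sub_pos.2 (ha t ht))]
      · simp only [if_neg (hne s hs)]
        refine ⟨(hγF s hs).1, hγy s hs, fun t ht => ?_⟩
        rw [Finset.mem_insert] at ht
        rcases ht with rfl | ht
        · simp only [if_true]
          rw [(hγF s hs).2.1, abs_sub_comm, abs_of_pos (sub_pos.2 (ha s hs))]
        · rw [if_neg (hne t ht)]
          exact (hγF s hs).2.2 t ht

/-- Proper length spaces are geodesic. -/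
theorem exists_isometric_path
    (hlen : ∀ (x y : X) (a b : ℝ), 0 < a → 0 < b → dist x y < a + b →
      ∃ z, dist x z < a ∧ dist z y < b)
    (x y : X) : ∃ γ : ℝ → X, γ 0 = x ∧ γ (dist x y) = y ∧
    ∀ s ∈ Icc 0 (dist x y), ∀ t ∈ Icc 0 (dist x y), dist (γ s) (γ t) = |s - t| := by
  set I := Icc 0 (dist x y) with hI
  -- Tychonoff: maps into a closed ball form a compact set, and the isometry conditions are closed
  -- with the finite intersection property.
  have hK : IsCompact (Set.pi univ fun _ : ℝ => closedBall x (dist x y)) :=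
    isCompact_univ_pi fun _ => isCompact_closedBall _ _
  obtain ⟨γ, -, hγ⟩ := hK.inter_iInter_nonempty
    (fun p : I × I => {γ : ℝ → X | dist x (γ p.1) = p.1 ∧ dist (γ p.1) y = dist x y - p.1 ∧
      dist (γ p.1) (γ p.2) = |(p.1 : ℝ) - p.2|})
    (fun p => by
      refine (isClosed_eq (by fun_prop) (by fun_prop)).inter
        ((isClosed_eq (by fun_prop) (by fun_prop)).inter
          (isClosed_eq (by fun_prop) (by fun_prop))))
    (fun u => by
      classical
      obtain ⟨γ, h1, h2⟩ := exists_isometric_on_finset hlen x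
        (u.image (fun p => (p.1 : ℝ)) ∪ u.image (fun p => (p.2 : ℝ))) y (by
          intro s hs
          simp only [Finset.mem_union, Finset.mem_image] at hs
          rcases hs with ⟨p, -, rfl⟩ | ⟨p, -, rfl⟩
          · exact p.1.2
          · exact p.2.2)
      refine ⟨γ, fun t _ => mem_closedBall'.2 (h1 t), mem_iInter₂.2 fun p hp => ?_⟩
      have hp1 := Finset.mem_union_left (u.image (fun p => (p.2 : ℝ)))
        (Finset.mem_image_of_mem (fun p : I × I => (p.1 : ℝ)) hp)
      have hp2 := Finset.mem_union_right (u.image (fun p => (p.1 : ℝ)))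
        (Finset.mem_image_of_mem (fun p : I × I => (p.2 : ℝ)) hp)
      obtain ⟨h3, h4, h5⟩ := h2 _ hp1
      exact ⟨h3, h4, h5 _ hp2⟩)
  rw [mem_iInter] at hγ
  have h0 : (0 : ℝ) ∈ I := ⟨le_rfl, dist_nonneg⟩
  have h1 : dist x y ∈ I := ⟨dist_nonneg, le_rfl⟩
  refine ⟨γ, ?_, ?_, fun s hs t ht => (hγ (⟨s, hs⟩, ⟨t, ht⟩)).2.2⟩
  · exact (dist_eq_zero.1 (hγ (⟨0, h0⟩, ⟨0, h0⟩)).1).symm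
  · refine dist_eq_zero.1 ?_
    have := (hγ (⟨_, h1⟩, ⟨_, h1⟩)).2.1
    simpa using this

end HopfRinow

/-! ### The metric space `(D, K_D)` and its geodesics. -/

variable {d : ℕ} {D : Set (EuclideanSpace ℂ (Fin d))}

/-- The points of `D`, to be endowed with the metric `K_D`. -/
structure KobSpace (D : Set (EuclideanSpace ℂ (Fin d))) where
  /-- The underlying point. -/
  pt : EuclideanSpace ℂ (Fin d)
  mem : pt ∈ D

/-- The metric space `(D, K_D)`. -/
noncomputable abbrev kobMetricSpace (hfin : ∀ x ∈ D, ∀ y ∈ D, kobDist D x y ≠ ∞)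
    (hsep : ∀ x ∈ D, ∀ y ∈ D, kobDist D x y = 0 → x = y) : MetricSpace (KobSpace D) :=
  letI : EMetricSpace (KobSpace D) :=
    { edist := fun x y => kobDist D x.pt y.pt
      edist_self := fun x => kobDist_self x.mem
      edist_comm := fun x y => kobDist_comm x.pt y.pt
      edist_triangle := fun x y z => kobDist_triangle x.pt y.pt z.pt
      eq_of_edist_eq_zero := fun {x y} h => by cases x; cases y; congr; exact hsep _ ‹_› _ ‹_› h }
  EMetricSpace.toMetricSpace fun x y => hfin x.pt x.mem y.pt y.mem

/-- Closed balls of a complete hyperbolic bounded open set are compact, and it is a geodesic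
space. -/
theorem IsCompleteHyperbolic.hopfRinow (hD : IsOpen D) (hb : Bornology.IsBounded D)
    (hc : IsCompleteHyperbolic D) :
    (∀ o ∈ D, ∀ M : ℝ, 0 ≤ M → IsCompact {z | z ∈ D ∧ kobDist D o z ≤ ENNReal.ofReal M}) ∧
      ∀ x ∈ D, ∀ y ∈ D, ∃ S, IsGeodesicSegment D x y S := by
  obtain ⟨hfin, hsep, hcomp⟩ := hc
  obtain ⟨M, hM, hDM⟩ := hb.subset_ball_lt 0 0
  let := kobMetricSpace hfin hsep
  have hed : ∀ x y : KobSpace D, edist x y = kobDist D x.pt y.pt := fun _ _ => rfl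
  have hcont : Continuous fun x : KobSpace D => x.pt := by
    refine LipschitzWith.continuous (K := (2 * M).toNNReal) fun x y => ?_
    have h1 := norm_sub_le_kobDist hM hDM x.pt y.pt
    rw [ENNReal.ofReal_div_of_pos (by positivity), ENNReal.div_le_iff
      (ENNReal.ofReal_pos.2 (by positivity)).ne' ENNReal.ofReal_ne_top] at h1
    rw [edist_dist, dist_eq_norm, hed, mul_comm]
    exact h1
  -- With `hcont`, this identifies the `K_D`-topology with the Euclidean one, so small closed
  -- Euclidean balls are compact for `K_D`.
  have hcont' : Continuous fun x : {x // x ∈ D} => (⟨x.1, x.2⟩ : KobSpace D) := by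
    rw [continuous_iff_continuousAt]
    intro x
    rw [ContinuousAt, tendsto_iff_edist_tendsto_0]
    refine ((tendsto_kobDist_nhds hD x.2).comp
      continuous_subtype_val.continuousAt).congr fun y => ?_
    rw [hed]
    exact kobDist_comm _ _
  have : CompleteSpace (KobSpace D) := by
    refine EMetric.complete_of_cauchySeq_tendsto fun u hu => ?_
    rw [EMetric.cauchySeq_iff] at hu
    obtain ⟨x, hx, hux⟩ := hcomp (fun n => (u n).pt) (fun n => (u n).mem) hu
    exact ⟨⟨x, hx⟩, tendsto_iff_edist_tendsto_0.2 hux⟩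
  have : WeaklyLocallyCompactSpace (KobSpace D) := by
    refine ⟨fun x => ?_⟩
    obtain ⟨r, hr, hrD⟩ := Metric.nhds_basis_closedBall.mem_iff.1 (hD.mem_nhds x.mem)
    refine ⟨(fun x : KobSpace D => x.pt) ⁻¹' closedBall x.pt r, ?_,
      hcont.continuousAt.preimage_mem_nhds (closedBall_mem_nhds _ hr)⟩
    have h1 : IsCompact ((fun x : {x // x ∈ D} => x.1) ⁻¹' closedBall x.pt r) := by
      rw [Subtype.isCompact_iff, Subtype.image_preimage_coe, inter_eq_right.2 hrD]
      exact isCompact_closedBall _ _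
    convert h1.image hcont' using 1
    ext z
    constructor
    · exact fun hz => ⟨⟨z.pt, z.mem⟩, hz, rfl⟩
    · rintro ⟨w, hw, rfl⟩
      exact hw
  have hlen : ∀ (x y : KobSpace D) (a b : ℝ), 0 < a → 0 < b → dist x y < a + b →
      ∃ z, dist x z < a ∧ dist z y < b := by
    intro x y a b ha hb h
    have h1 : kobDist D x.pt y.pt < ENNReal.ofReal a + ENNReal.ofReal b := by
      rw [← ENNReal.ofReal_add ha.le hb.le, ← hed, edist_dist]
      exact (ENNReal.ofReal_lt_ofReal_iff (by positivity)).2 h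
    obtain ⟨z, hz, hz1, hz2⟩ := exists_between_of_kobDist_lt (ENNReal.ofReal_pos.2 ha)
      (ENNReal.ofReal_pos.2 hb) h1
    refine ⟨⟨z, hz⟩, ?_, ?_⟩
    · rw [← ENNReal.ofReal_lt_ofReal_iff ha, ← edist_dist]; exact hz1
    · rw [← ENNReal.ofReal_lt_ofReal_iff hb, ← edist_dist]; exact hz2
  have := properSpace_of_complete_length hlen
  constructor
  · intro o ho N hN
    convert (isCompact_closedBall (⟨o, ho⟩ : KobSpace D) N).image hcont using 1
    ext z
    constructor
    · rintro ⟨hz, hzN⟩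
      refine ⟨⟨z, hz⟩, ?_, rfl⟩
      rw [mem_closedBall', ← ENNReal.ofReal_le_ofReal_iff hN, ← edist_dist]
      exact hzN
    · rintro ⟨z, hzN, rfl⟩
      refine ⟨z.mem, ?_⟩
      rw [mem_closedBall', ← ENNReal.ofReal_le_ofReal_iff hN, ← edist_dist] at hzN
      exact hzN
  · intro x hx y hy
    obtain ⟨γ, h0, h1, h⟩ := exists_isometric_path hlen ⟨x, hx⟩ ⟨y, hy⟩
    refine ⟨_, dist (⟨x, hx⟩ : KobSpace D) ⟨y, hy⟩, fun t => (γ t).pt, dist_nonneg, congrArg KobSpace.pt h0,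
      congrArg KobSpace.pt h1, fun t _ => (γ t).mem, fun s hs t ht => ?_, rfl⟩
    rw [← h s hs t ht, ← edist_dist]
    rfl

end

/-! ### The real-valued distance and discrete chains. -/

section

variable {d : ℕ} {D Ω V : Set (EuclideanSpace ℂ (Fin d))}

/-- Bounded open connected sets. -/
structure IsBoundedDomain (D : Set (EuclideanSpace ℂ (Fin d))) : Prop where
  isOpen : IsOpen D
  isPreconnected : IsPreconnected D
  isBounded : Bornology.IsBounded D

/-- The real-valued Kobayashi distance. -/
noncomputable def kd (D : Set (EuclideanSpace ℂ (Fin d))) (x y : EuclideanSpace ℂ (Fin d)) : ℝ :=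
  (kobDist D x y).toReal

theorem kd_nonneg (x y : EuclideanSpace ℂ (Fin d)) : 0 ≤ kd D x y := ENNReal.toReal_nonneg

theorem kd_comm (x y : EuclideanSpace ℂ (Fin d)) : kd D x y = kd D y x := by
  rw [kd, kobDist_comm, kd]

theorem kd_self {x : EuclideanSpace ℂ (Fin d)} (hx : x ∈ D) : kd D x x = 0 := by
  rw [kd, kobDist_self hx, ENNReal.toReal_zero]

namespace IsBoundedDomain

variable {x y z : EuclideanSpace ℂ (Fin d)}

theorem kobDist_ne_top (hD : IsBoundedDomain D) (hx : x ∈ D) (hy : y ∈ D) : kobDist D x y ≠ ∞ :=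
  Kobayashi.kobDist_ne_top hD.isOpen hD.isPreconnected hx hy

theorem ofReal_kd (hD : IsBoundedDomain D) (hx : x ∈ D) (hy : y ∈ D) :
    ENNReal.ofReal (kd D x y) = kobDist D x y :=
  ENNReal.ofReal_toReal (hD.kobDist_ne_top hx hy)

theorem kd_triangle (hD : IsBoundedDomain D) (hx : x ∈ D) (hy : y ∈ D) (hz : z ∈ D) :
    kd D x z ≤ kd D x y + kd D y z := by
  rw [kd, kd, kd, ← ENNReal.toReal_add (hD.kobDist_ne_top hx hy) (hD.kobDist_ne_top hy hz)]
  exact ENNReal.toReal_mono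
    (ENNReal.add_ne_top.2 ⟨hD.kobDist_ne_top hx hy, hD.kobDist_ne_top hy hz⟩)
    (kobDist_triangle x y z)

theorem kd_anti (hD : IsBoundedDomain D) (hDΩ : D ⊆ Ω) (hx : x ∈ D) (hy : y ∈ D) :
    kd Ω x y ≤ kd D x y :=
  ENNReal.toReal_mono (hD.kobDist_ne_top hx hy) (kobDist_mono hDΩ x y)

theorem exists_mul_dist_le_kd (hD : IsBoundedDomain D) :
    ∃ c > 0, ∀ x ∈ D, ∀ y ∈ D, c * dist x y ≤ kd D x y := by
  obtain ⟨M, hM, hDM⟩ := hD.isBounded.subset_ball_lt 0 0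
  refine ⟨1 / (2 * M), by positivity, fun x hx y hy => ?_⟩
  have := norm_sub_le_kobDist hM hDM x y
  rw [← hD.ofReal_kd hx hy, ENNReal.ofReal_le_ofReal_iff (kd_nonneg x y)] at this
  rw [dist_eq_norm]
  calc _ = ‖x - y‖ / (2 * M) := by ring
    _ ≤ _ := this

theorem tendsto_kd_nhds (hD : IsBoundedDomain D) (hx : x ∈ D) :
    Tendsto (fun y => kd D x y) (𝓝 x) (𝓝 0) :=
  (ENNReal.tendsto_toReal ENNReal.zero_ne_top).comp (tendsto_kobDist_nhds hD.isOpen hx)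

theorem continuousOn_kd (hD : IsBoundedDomain D) (ho : x ∈ D) :
    ContinuousOn (fun y => kd D x y) D := by
  intro y hy
  rw [ContinuousWithinAt, tendsto_iff_dist_tendsto_zero]
  refine squeeze_zero' (Eventually.of_forall fun _ => dist_nonneg) ?_
    ((hD.tendsto_kd_nhds hy).mono_left nhdsWithin_le_nhds)
  filter_upwards [self_mem_nhdsWithin] with w hw
  rw [Real.dist_eq, abs_le]
  have h1 := hD.kd_triangle ho hy hw
  have h2 := hD.kd_triangle ho hw hy
  rw [kd_comm w y] at h2
  constructor <;> linarith

theorem exists_between (hD : IsBoundedDomain D) (hx : x ∈ D) (hy : y ∈ D) {a b : ℝ} (ha : 0 < a)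
    (hb : 0 < b) (h : kd D x y < a + b) : ∃ z ∈ D, kd D x z < a ∧ kd D z y < b := by
  have h1 : kobDist D x y < ENNReal.ofReal a + ENNReal.ofReal b := by
    rw [← ENNReal.ofReal_add ha.le hb.le, ← hD.ofReal_kd hx hy]
    exact (ENNReal.ofReal_lt_ofReal_iff (by positivity)).2 h
  obtain ⟨z, hz, hz1, hz2⟩ := exists_between_of_kobDist_lt (ENNReal.ofReal_pos.2 ha)
    (ENNReal.ofReal_pos.2 hb) h1
  refine ⟨z, hz, ?_, ?_⟩
  · rwa [← hD.ofReal_kd hx hz, ENNReal.ofReal_lt_ofReal_iff ha] at hz1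
  · rwa [← hD.ofReal_kd hz hy, ENNReal.ofReal_lt_ofReal_iff hb] at hz2

/-- Such chains stand in for geodesics, whose existence in `Ω` is not available before completeness
is known. -/
theorem exists_uniform_chain (hD : IsBoundedDomain D) {h : ℝ} (hh : 0 < h) (N : ℕ)
    (hx : x ∈ D) (hy : y ∈ D) (hxy : kd D x y < (N + 1) * h) :
    ∃ z : ℕ → EuclideanSpace ℂ (Fin d), z 0 = x ∧ z (N + 1) = y ∧ (∀ i, z i ∈ D) ∧
      ∀ i ≤ N, kd D (z i) (z (i + 1)) < h := by
  induction N generalizing x with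
  | zero =>
    refine ⟨fun i => if i = 0 then x else y, by simp, by simp, fun i => ?_, fun i hi => ?_⟩
    · dsimp only
      split_ifs
      exacts [hx, hy]
    · obtain rfl : i = 0 := by omega
      simpa using hxy
  | succ N ih =>
    obtain ⟨w, hw, hw1, hw2⟩ := hD.exists_between hx hy hh (b := (N + 1) * h) (by positivity)
      (by push_cast at hxy; linarith)
    obtain ⟨z, hz0, hzN, hz, hzi⟩ := ih hw hw2
    refine ⟨fun i => if i = 0 then x else z (i - 1), by simp, by simpa using hzN,
      fun i => ?_, fun i hi => ?_⟩
    · dsimp only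
      split_ifs
      exacts [hx, hz _]
    · rcases i with - | i
      · simpa [hz0] using hw1
      · simpa using hzi i (by omega)

theorem kd_le_of_chain (hD : IsBoundedDomain D) {h : ℝ} {z : ℕ → EuclideanSpace ℂ (Fin d)}
    (hz : ∀ i, z i ∈ D) {m n : ℕ} (hmn : m ≤ n)
    (hzi : ∀ i, m ≤ i → i < n → kd D (z i) (z (i + 1)) < h) :
    kd D (z m) (z n) ≤ (n - m) * h := by
  induction n, hmn using Nat.le_induction with
  | base => simp [kd_self (hz m)]
  | succ n hmn ih =>
    have h1 := ih fun i hi hin => hzi i hi (by omega)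
    have h2 := hzi n hmn (by omega)
    have h3 := hD.kd_triangle (hz m) (hz n) (hz (n + 1))
    push_cast
    linarith

theorem kd_le_sum (hD : IsBoundedDomain D) {z : ℕ → EuclideanSpace ℂ (Fin d)} (n : ℕ)
    (hz : ∀ i ≤ n, z i ∈ D) :
    kd D (z 0) (z n) ≤ ∑ i ∈ Finset.range n, kd D (z i) (z (i + 1)) := by
  induction n with
  | zero => simp [kd_self (hz 0 le_rfl)]
  | succ n ih =>
    rw [Finset.sum_range_succ]
    have := ih fun i hi => hz i (by omega)
    linarith [hD.kd_triangle (hz 0 (by omega)) (hz n (by omega)) (hz (n + 1) le_rfl)]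

theorem kd_inter_le (hΩ : IsBoundedDomain Ω) {R s : ℝ} (hsR : s < R) (hx : x ∈ Ω) (hy : y ∈ Ω)
    (hR : ∀ w ∈ Ω, w ∉ V → R ≤ kd Ω x w) (h : kd Ω x y < s) :
    kd (Ω ∩ V) x y ≤ s / Real.tanh (R - s) := by
  have hs0 : 0 < s := (kd_nonneg x y).trans_lt h
  have := kobDist_inter_le hsR (V := V) (Ω := Ω) (x := x) (y := y)
    (fun w hw hwV => by
      rw [← hΩ.ofReal_kd hx hw]; exact ENNReal.ofReal_le_ofReal (hR w hw hwV))
    (by rw [← hΩ.ofReal_kd hx hy]; exact (ENNReal.ofReal_lt_ofReal_iff hs0).2 h)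
  exact ENNReal.toReal_le_of_le_ofReal (div_nonneg hs0.le (tanh_pos (sub_pos.2 hsR)).le) this

end IsBoundedDomain

/-! ### First exit from a ball, and the numerical estimates for summing errors. -/

theorem exists_first_exit {X : Type*} [PseudoMetricSpace X] (z : ℕ → X) (p : X) {a : ℝ} {n : ℕ}
    (h0 : dist (z 0) p < a) (hn : a ≤ dist (z n) p) :
    ∃ j, 0 < j ∧ j ≤ n ∧ (∀ i < j, dist (z i) p < a) ∧ a ≤ dist (z j) p := by
  classical
  have hex : ∃ j, a ≤ dist (z j) p := ⟨n, hn⟩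
  refine ⟨Nat.find hex, ?_, Nat.find_min' hex hn, fun i hi => not_le.1 (Nat.find_min hex hi),
    Nat.find_spec hex⟩
  rw [Nat.find_pos]
  exact h0.not_ge

/-- The constant bound `u` covers the range where the affine bound is weak or negative, so the two
merge into one bound proportional to `1 + t`. -/
theorem exists_linear_lower_bound {u a : ℝ} (b : ℝ) (hu : 0 < u) (ha : 0 < a) :
    ∃ c > 0, ∀ t R : ℝ, u ≤ R → a * t - b ≤ R → c * (1 + t) ≤ R := by
  have hB : 0 ≤ max b 0 := le_max_right _ _
  set B := max b 0 with hBdef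
  have hden : 0 < 1 / u + 1 / a + B / (a * u) := by positivity
  refine ⟨(1 / u + 1 / a + B / (a * u))⁻¹, by positivity, fun t R h1 h2 => ?_⟩
  rw [inv_mul_le_iff₀ hden]
  have h3 : t ≤ (R + B) / a := by
    rw [le_div_iff₀ ha]
    linarith [le_max_left b 0]
  have h4 : 1 ≤ R / u := by rwa [one_le_div hu]
  have h5 : B / a ≤ B / a * (R / u) := le_mul_of_one_le_right (by positivity) h4
  have h6 : (1 / u + 1 / a + B / (a * u)) * R = R / u + R / a + B / a * (R / u) := by
    field_simp
  have h7 : (R + B) / a = R / a + B / a := add_div _ _ _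
  linarith

/-- `t / (1 + |t|)` is a primitive of `1 / (1 + |t|) ^ 2`; the factor `1 / 2` pays for using the
value at the left endpoint on a step of length at most `1`. -/
theorem half_mul_div_sq_le {t h : ℝ} (hh : 0 < h) (h1 : h ≤ 1) :
    1 / 2 * (h / (1 + |t|) ^ 2) ≤ (t + h) / (1 + |t + h|) - t / (1 + |t|) := by
  rcases le_or_gt 0 t with ht | ht
  · rw [abs_of_nonneg ht, abs_of_nonneg (by linarith)]
    have e : (t + h) / (1 + (t + h)) - t / (1 + t) = h / ((1 + t) * (1 + (t + h))) := by
      field_simp; ring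
    rw [e, ← mul_div_assoc, div_le_div_iff₀ (by positivity) (by positivity)]
    have : (1 + (t + h)) ≤ 2 * (1 + t) := by linarith
    have h2 : 0 < h * (1 + t) := by positivity
    nlinarith
  · rcases le_or_gt (t + h) 0 with hth | hth
    · rw [abs_of_neg ht, abs_of_nonpos hth]
      have p1 : 0 < 1 + -t := by linarith
      have p2 : 0 < 1 + -(t + h) := by linarith
      have e : (t + h) / (1 + -(t + h)) - t / (1 + -t) =
          h / ((1 + -t) * (1 + -(t + h))) := by
        field_simp; ring
      rw [e, ← mul_div_assoc, div_le_div_iff₀ (by positivity) (by positivity)]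
      have h2 : 0 < h * (1 + -t) := by positivity
      nlinarith
    · rw [abs_of_neg ht, abs_of_pos hth]
      have p1 : 0 < 1 + -t := by linarith
      have e1 : (t + h) / 2 ≤ (t + h) / (1 + (t + h)) :=
        div_le_div_of_nonneg_left hth.le (by linarith) (by linarith)
      have e2 : -t / 2 ≤ -t / (1 + -t) :=
        div_le_div_of_nonneg_left (by linarith) (by linarith) (by linarith)
      have e3 : h / (1 + -t) ^ 2 ≤ h := div_le_self hh.le (by nlinarith)
      have e4 : -t / (1 + -t) = -(t / (1 + -t)) := neg_div _ _
      linarith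

/-- Telescoping with that primitive, which takes values in `[-1, 1]`, bounds half the sum by `2`,
whatever `m`, `n` and `h`. -/
theorem sum_div_sq_le {h : ℝ} (hh : 0 < h) (h1 : h ≤ 1) (m n : ℕ) :
    ∑ i ∈ Finset.range n, h / (1 + |(i : ℝ) - m| * h) ^ 2 ≤ 4 := by
  set G : ℝ → ℝ := fun t => t / (1 + |t|) with hG
  have hG1 : ∀ t, |G t| ≤ 1 := fun t => by
    have : 0 ≤ |t| := abs_nonneg t
    simp only [hG, abs_div]
    rw [abs_of_nonneg (by linarith : 0 ≤ 1 + |t|), div_le_one (by linarith)]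
    linarith
  have key : ∑ i ∈ Finset.range n, 1 / 2 * (h / (1 + |(i : ℝ) - m| * h) ^ 2) ≤
      ∑ i ∈ Finset.range n, (G ((((i + 1 : ℕ) : ℝ) - m) * h) - G (((i : ℝ) - m) * h)) := by
    refine Finset.sum_le_sum fun i _ => ?_
    have := half_mul_div_sq_le (t := ((i : ℝ) - m) * h) hh h1
    rw [abs_mul ((i : ℝ) - m), abs_of_pos hh] at this
    simp only [hG]
    rw [show (((i + 1 : ℕ) : ℝ) - m) * h = ((i : ℝ) - m) * h + h by push_cast; ring,
      abs_mul ((i : ℝ) - m), abs_of_pos hh]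
    exact this
  rw [Finset.sum_range_sub (fun i : ℕ => G (((i : ℝ) - m) * h)), ← Finset.mul_sum] at key
  have h2 := (abs_le.1 (hG1 (((n : ℝ) - m) * h))).2
  have h3 := (abs_le.1 (hG1 ((((0 : ℕ) : ℝ) - m) * h))).1
  have h4 := key.trans (sub_le_sub h2 h3)
  linarith

end

/-! ### Gromov products and the additive localisation of the distance. -/

section

variable {d : ℕ} {D Ω V : Set (EuclideanSpace ℂ (Fin d))}

theorem IsGeodesicSegment.kd_eq_add {x y c : EuclideanSpace ℂ (Fin d)}
    {S : Set (EuclideanSpace ℂ (Fin d))} (hS : IsGeodesicSegment D x y S) (hc : c ∈ S) :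
    kd D x y = kd D x c + kd D c y := by
  obtain ⟨L, γ, hL, rfl, rfl, -, h, rfl⟩ := hS
  obtain ⟨t, ht, rfl⟩ := hc
  have h0 : (0 : ℝ) ∈ Icc 0 L := ⟨le_rfl, hL⟩
  have h1 : L ∈ Icc 0 L := ⟨hL, le_rfl⟩
  simp only [kd, h _ h0 _ h1, h _ h0 _ ht, h _ ht _ h1, ENNReal.toReal_ofReal (abs_nonneg _)]
  rw [abs_of_nonpos (by linarith), abs_of_nonpos (by linarith [ht.1]),
    abs_of_nonpos (by linarith [ht.2])]
  ring

/-- Visibility bounds Gromov products of points close to distinct boundary points. -/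
theorem IsBoundedDomain.exists_gromov_product_bound (hD : IsBoundedDomain D)
    (hc : IsCompleteHyperbolic D) {p q o : EuclideanSpace ℂ (Fin d)} (ho : o ∈ D)
    (hv : HasVisibility D p q) :
    ∃ P ∈ 𝓝 p, ∃ Q ∈ 𝓝 q, ∃ C : ℝ, ∀ x ∈ D ∩ P, ∀ y ∈ D ∩ Q,
      kd D x o + kd D y o ≤ kd D x y + C := by
  obtain ⟨P, hP, Q, hQ, K, hKD, hK, -, hv⟩ := hv
  obtain ⟨B, hB⟩ := (hK.image_of_continuousOn ((hD.continuousOn_kd ho).mono hKD)).bddAbove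
  refine ⟨P, hP, Q, hQ, 2 * B, fun x hx y hy => ?_⟩
  obtain ⟨S, hS⟩ := (hc.hopfRinow hD.isOpen hD.isBounded).2 x hx.1 y hy.1
  obtain ⟨c, hcS, hcK⟩ := hv x hx y hy S hS
  have h1 := hS.kd_eq_add hcS
  have h2 : kd D o c ≤ B := hB (mem_image_of_mem _ hcK)
  have h3 := hD.kd_triangle hx.1 (hKD hcK) ho
  have h4 := hD.kd_triangle hy.1 (hKD hcK) ho
  rw [kd_comm c o] at h3 h4
  rw [kd_comm y c] at h4
  linarith

/-- Uniform bound for Gromov products in a locally visible intersection. -/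
theorem exists_uniform_gromov_product_bound (hΩ : IsBoundedDomain Ω)
    (hD : IsBoundedDomain (Ω ∩ V)) (hc : IsCompleteHyperbolic (Ω ∩ V))
    {V' : Set (EuclideanSpace ℂ (Fin d))} (hV' : V' ⊆ V)
    (hvis : ∀ q₁ ∈ frontier Ω ∩ V', ∀ q₂ ∈ frontier Ω ∩ V', q₁ ≠ q₂ →
      HasVisibility (Ω ∩ V) q₁ q₂)
    {p o : EuclideanSpace ℂ (Fin d)} (ho : o ∈ Ω ∩ V) {r : ℝ} (hr : closedBall p r ⊆ V')
    {ra rb : ℝ} (hab : ra < rb) (har : ra ≤ r) :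
    ∃ C : ℝ, ∀ x ∈ Ω, ∀ y ∈ Ω, dist x p ≤ ra → rb ≤ dist y p → dist y p ≤ r →
      kd (Ω ∩ V) x o + kd (Ω ∩ V) y o ≤ kd (Ω ∩ V) x y + C := by
  set D := Ω ∩ V with hDdef
  set K : Set (EuclideanSpace ℂ (Fin d) × EuclideanSpace ℂ (Fin d)) :=
    closedBall p ra ×ˢ (closedBall p r ∩ {y | rb ≤ dist y p}) with hK
  have hKc : IsCompact K := (isCompact_closedBall p ra).prod
    ((isCompact_closedBall p r).inter_right (isClosed_le (by fun_prop) (by fun_prop)))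
  have main : ∃ C : ℝ, ∀ q ∈ K, q.1 ∈ D → q.2 ∈ D →
      kd D q.1 o + kd D q.2 o ≤ kd D q.1 q.2 + C := by
    -- The bound is local on pairs, so compactness of `K` suffices; `ra < rb` keeps the two
    -- coordinates distinct.
    refine hKc.induction_on (p := fun T => ∃ C : ℝ, ∀ q ∈ T, q.1 ∈ D → q.2 ∈ D →
      kd D q.1 o + kd D q.2 o ≤ kd D q.1 q.2 + C) ⟨0, by simp⟩ ?_ ?_ ?_
    · rintro s t hst ⟨C, hC⟩
      exact ⟨C, fun q hq => hC q (hst hq)⟩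
    · rintro s t ⟨C₁, h₁⟩ ⟨C₂, h₂⟩
      refine ⟨max C₁ C₂, fun q hq hq1 hq2 => ?_⟩
      rcases hq with hq | hq
      · linarith [h₁ q hq hq1 hq2, le_max_left C₁ C₂]
      · linarith [h₂ q hq hq1 hq2, le_max_right C₁ C₂]
    · rintro ⟨x, y⟩ ⟨hx, hyr, hyb⟩
      have hxV' : x ∈ V' := hr (closedBall_subset_closedBall har hx)
      have hyV' : y ∈ V' := hr hyr
      suffices ∃ P ∈ 𝓝 x, ∃ Q ∈ 𝓝 y, ∃ C : ℝ, ∀ x' ∈ D ∩ P, ∀ y' ∈ D ∩ Q,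
          kd D x' o + kd D y' o ≤ kd D x' y' + C by
        obtain ⟨P, hP, Q, hQ, C, hC⟩ := this
        exact ⟨P ×ˢ Q, nhdsWithin_le_nhds (prod_mem_nhds hP hQ), C,
          fun q hq h1 h2 => hC q.1 ⟨h1, hq.1⟩ q.2 ⟨h2, hq.2⟩⟩
      have near : ∀ z ∈ D, ∃ P ∈ 𝓝 z, ∀ z' ∈ D ∩ P, kd D z' o ≤ kd D z o + 1 := fun z hz => by
        refine ⟨{w | kd D z w < 1}, (hD.tendsto_kd_nhds hz).eventually_lt_const one_pos, ?_⟩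
        rintro z' ⟨hz', h⟩
        have := hD.kd_triangle hz' hz ho
        rw [kd_comm z' z] at this
        have h' : kd D z z' < 1 := h
        linarith
      -- Visibility is needed only when both points lie on the boundary. A point of `Ω` stays at
      -- bounded distance from `o` nearby, and a point off `closure Ω` has a neighbourhood missing
      -- `Ω`.
      by_cases hxΩ : x ∈ Ω
      · have hxD : x ∈ D := ⟨hxΩ, hV' hxV'⟩
        obtain ⟨P, hP, hPx⟩ := near x hxD
        refine ⟨P, hP, univ, univ_mem, 2 * (kd D x o + 1), fun x' hx' y' hy' => ?_⟩
        have h1 := hPx x' hx'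
        have h2 := hD.kd_triangle hy'.1 hx'.1 ho
        rw [kd_comm y' x'] at h2
        linarith
      by_cases hyΩ : y ∈ Ω
      · have hyD : y ∈ D := ⟨hyΩ, hV' hyV'⟩
        obtain ⟨Q, hQ, hQy⟩ := near y hyD
        refine ⟨univ, univ_mem, Q, hQ, 2 * (kd D y o + 1), fun x' hx' y' hy' => ?_⟩
        have h1 := hQy y' hy'
        have h2 := hD.kd_triangle hx'.1 hy'.1 ho
        linarith
      by_cases hxc : x ∈ closure Ω
      · by_cases hyc : y ∈ closure Ω
        · refine hD.exists_gromov_product_bound hc ho (hvis x ⟨?_, hxV'⟩ y ⟨?_, hyV'⟩ ?_)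
          · exact ⟨hxc, by rwa [hΩ.isOpen.interior_eq]⟩
          · exact ⟨hyc, by rwa [hΩ.isOpen.interior_eq]⟩
          · rintro rfl
            have h1 : dist x p ≤ ra := hx
            have h2 : rb ≤ dist x p := hyb
            linarith
        · exact ⟨univ, univ_mem, _, isClosed_closure.isOpen_compl.mem_nhds hyc, 0,
            fun x' _ y' hy' => absurd (subset_closure hy'.1.1) hy'.2⟩
      · exact ⟨_, isClosed_closure.isOpen_compl.mem_nhds hxc, univ, univ_mem, 0,
          fun x' hx' y' _ => absurd (subset_closure hx'.1.1) hx'.2⟩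
  obtain ⟨C, hC⟩ := main
  refine ⟨C, fun x hx y hy hxa hyb hyr => hC (x, y) ⟨hxa, hyr, hyb⟩ ⟨hx, ?_⟩ ⟨hy, ?_⟩⟩
  · exact hV' (hr (mem_closedBall.2 (hxa.trans har)))
  · exact hV' (hr (mem_closedBall.2 hyr))

/-- If Gromov products of the local distance are bounded, then near a boundary point
the global distance dominates the local one multiplicatively up to the exit, and Gromov products
of the global distance are bounded. -/
theorem exists_local_estimates (hΩ : IsBoundedDomain Ω) (hD : IsBoundedDomain (Ω ∩ V))
    {p o : EuclideanSpace ℂ (Fin d)} (ho : o ∈ Ω ∩ V) {ρ : ℝ} (hρ : 0 < ρ)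
    (hV : closedBall p (4 * ρ) ⊆ V)
    (hgp : ∀ ra rb : ℝ, ra < rb → ra ≤ 4 * ρ → ∃ C : ℝ, ∀ x ∈ Ω, ∀ y ∈ Ω, dist x p ≤ ra →
      rb ≤ dist y p → dist y p ≤ 4 * ρ →
      kd (Ω ∩ V) x o + kd (Ω ∩ V) y o ≤ kd (Ω ∩ V) x y + C) :
    (∃ A > 0, ∃ C : ℝ, ∀ x ∈ Ω, dist x p < 2 * ρ → ∀ y ∈ Ω, 3 * ρ ≤ dist y p →
      kd (Ω ∩ V) x o ≤ A * kd Ω x y + C) ∧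
    ∃ C : ℝ, ∀ x ∈ Ω, dist x p < ρ → ∀ y ∈ Ω, 2 * ρ ≤ dist y p →
      kd Ω x o + kd Ω y o ≤ kd Ω x y + C := by
  set D := Ω ∩ V with hDdef
  have hmemD : ∀ z ∈ Ω, dist z p ≤ 4 * ρ → z ∈ D := fun z hz h => ⟨hz, hV (mem_closedBall.2 h)⟩
  have hnotV : ∀ w, w ∉ V → 4 * ρ < dist w p := fun w hw =>
    lt_of_not_ge fun h => hw (hV (mem_closedBall.2 h))
  obtain ⟨c, hc, hcd⟩ := hΩ.exists_mul_dist_le_kd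
  -- At this scale a link moves less than `ρ`, and points of the `3 * ρ` ball are at `K_Ω`-distance
  -- at least `2 * h₀` from the outside of `V`.
  set h₀ := c * ρ / 2 with hh₀
  have hh₀pos : 0 < h₀ := by positivity
  have hsmall : ∀ x ∈ Ω, ∀ y ∈ Ω, kd Ω x y < h₀ → dist x y < ρ := fun x hx y hy h => by
    have h1 := (hcd x hx y hy).trans_lt h
    have h2 : c * dist x y < c * ρ := by linarith
    exact lt_of_mul_lt_mul_left h2 hc.le
  have hfar : ∀ x ∈ Ω, dist x p < 3 * ρ → ∀ w ∈ Ω, w ∉ V → 2 * h₀ ≤ kd Ω x w := by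
    intro x hx hxp w hw hwV
    have h1 := hnotV w hwV
    have h2 := dist_triangle w x p
    rw [dist_comm w x] at h2
    have h3 : c * ρ ≤ c * dist x w := mul_le_mul_of_nonneg_left (by linarith) hc.le
    linarith [hcd x hx w hw]
  -- Almost-geodesic chains: the total budget exceeds the distance by exactly `1`, however small the
  -- steps.
  have hchain : ∀ x ∈ Ω, ∀ y ∈ Ω, ∃ (N : ℕ) (h : ℝ) (z : ℕ → EuclideanSpace ℂ (Fin d)),
      0 < h ∧ h ≤ h₀ ∧ h ≤ 1 ∧ N * h = kd Ω x y + 1 ∧ z 0 = x ∧ z N = y ∧ (∀ i, z i ∈ Ω) ∧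
      ∀ i < N, kd Ω (z i) (z (i + 1)) < h := by
    intro x hx y hy
    set L := kd Ω x y + 1 with hL
    have hLpos : 0 < L := by linarith [kd_nonneg (D := Ω) x y]
    have hm : 0 < min h₀ 1 := by positivity
    obtain ⟨N, hN⟩ := exists_nat_ge (L / min h₀ 1)
    have hN1 : (0 : ℝ) < N + 1 := by positivity
    have hle : L / (N + 1) ≤ min h₀ 1 := by
      rw [div_le_iff₀ hm] at hN
      rw [div_le_iff₀ hN1]
      nlinarith
    have hmul : ((N : ℝ) + 1) * (L / (N + 1)) = L := mul_div_cancel₀ _ hN1.ne'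
    obtain ⟨z, h0, h1, h2, h3⟩ := hΩ.exists_uniform_chain (h := L / (N + 1)) (by positivity) N hx hy
      (by rw [hmul]; linarith)
    exact ⟨N + 1, L / (N + 1), z, by positivity, hle.trans (min_le_left _ _),
      hle.trans (min_le_right _ _), by push_cast; exact hmul, h0, h1, h2,
      fun i hi => h3 i (by omega)⟩
  have exit_dist : ∀ (z : ℕ → EuclideanSpace ℂ (Fin d)) (N j : ℕ) (h a : ℝ), h ≤ h₀ →
      (∀ i, z i ∈ Ω) → (∀ i < N, kd Ω (z i) (z (i + 1)) < h) → 0 < j → j ≤ N →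
      (∀ i < j, dist (z i) p < a) → dist (z j) p < a + ρ := by
    intro z N j h a hh hz hzi hj0 hjN hja
    obtain ⟨i, rfl⟩ : ∃ i, j = i + 1 := ⟨j - 1, by omega⟩
    have h1 := hsmall _ (hz i) _ (hz (i + 1)) ((hzi i (by omega)).trans_le hh)
    have h2 := dist_triangle (z (i + 1)) (z i) p
    rw [dist_comm (z (i + 1)) (z i)] at h2
    linarith [hja i (by omega)]
  -- Crude comparison: each link before the exit costs a factor at most `1 / tanh h₀`, and the
  -- Gromov product bound for `x` and the exit point turns the local length into a bound on `kd D x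
  -- o`.
  have step2 : ∃ A > 0, ∃ C : ℝ, ∀ x ∈ Ω, dist x p < 2 * ρ → ∀ y ∈ Ω, 3 * ρ ≤ dist y p →
      kd D x o ≤ A * kd Ω x y + C := by
    obtain ⟨C, hC⟩ := hgp (2 * ρ) (3 * ρ) (by linarith) (by linarith)
    have hτ := tanh_pos hh₀pos
    refine ⟨1 / Real.tanh h₀, by positivity, 1 / Real.tanh h₀ + C, fun x hx hxp y hy hyp => ?_⟩
    obtain ⟨N, h, z, hh, hh1, -, hNh, rfl, rfl, hz, hzi⟩ := hchain x hx y hy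
    obtain ⟨j, hj0, hjN, hja, hj⟩ := exists_first_exit z p (a := 3 * ρ) (by linarith) hyp
    have hjp := exit_dist z N j h (3 * ρ) hh1 hz hzi hj0 hjN hja
    have hlink : ∀ i < j, kd D (z i) (z (i + 1)) ≤ h / Real.tanh h₀ := by
      intro i hi
      have h1 := hΩ.kd_inter_le (s := h) (R := h₀ + h) (V := V) (by linarith) (hz i) (hz (i + 1))
        (fun w hw hwV => by linarith [hfar _ (hz i) (hja i hi) w hw hwV]) (hzi i (by omega))
      rwa [add_sub_cancel_right] at h1
    have hsum := hD.kd_le_sum (z := z) j fun i hi => hmemD _ (hz i) (by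
      rcases hi.lt_or_eq with hi | rfl
      · linarith [hja i hi]
      · linarith)
    have hsum2 : ∑ i ∈ Finset.range j, kd D (z i) (z (i + 1)) ≤ j * (h / Real.tanh h₀) := by
      refine (Finset.sum_le_card_nsmul _ _ _ fun i hi => hlink i (Finset.mem_range.1 hi)).trans ?_
      simp
    have hjN' : (j : ℝ) ≤ N := by exact_mod_cast hjN
    have h1 : (j : ℝ) * (h / Real.tanh h₀) ≤ 1 / Real.tanh h₀ * (kd Ω (z 0) (z N) + 1) := by
      rw [← hNh]
      calc (j : ℝ) * (h / Real.tanh h₀) ≤ N * (h / Real.tanh h₀) := by gcongr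
        _ = _ := by ring
    have h2 := hC (z 0) (hz 0) (z j) (hz j) hxp.le hj (by linarith)
    have h3 := kd_nonneg (D := D) (z j) o
    linarith
  refine ⟨step2, ?_⟩
  obtain ⟨A, hA, C, hAC⟩ := step2
  obtain ⟨C', hC'⟩ := hgp ρ (2 * ρ) (by linarith) (by linarith)
  obtain ⟨a, ha, hlow⟩ := exists_linear_lower_bound (u := h₀) (a := 1 / (2 * A))
    (1 / (2 * A) + C / A + h₀) hh₀pos (by positivity)
  refine ⟨1 + 4 / a ^ 2 + C', fun x hx hxp y hy hyp => ?_⟩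
  obtain ⟨N, h, z, hh, hh1, hh2, hNh, rfl, rfl, hz, hzi⟩ := hchain x hx y hy
  obtain ⟨j, hj0, hjN, hja, hj⟩ := exists_first_exit z p (a := 2 * ρ) (by linarith) hyp
  have hjp := exit_dist z N j h (2 * ρ) hh1 hz hzi hj0 hjN hja
  have hzD : ∀ i ≤ j, z i ∈ D := fun i hi => hmemD _ (hz i) (by
    rcases hi.lt_or_eq with hi | rfl
    · linarith [hja i hi]
    · linarith)
  -- `z m` is the chain point nearest to `o` before the exit; by `hspread`, distances to `o` grow
  -- linearly in `|i - m| * h`.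
  obtain ⟨m, hm, hmin⟩ := Finset.exists_min_image (Finset.range j) (fun i => kd Ω (z i) o)
    ⟨0, Finset.mem_range.2 hj0⟩
  rw [Finset.mem_range] at hm
  have hmono : ∀ i i', i ≤ i' → i' ≤ N → ((i' : ℝ) - i) * h - 1 ≤ kd Ω (z i) (z i') := by
    intro i i' hii hiN
    have h1 := hΩ.kd_triangle (hz 0) (hz i) (hz N)
    have h2 := hΩ.kd_triangle (hz i) (hz i') (hz N)
    have h3 := hΩ.kd_le_of_chain hz (Nat.zero_le i) fun k _ hk => hzi k (by omega)
    have h4 := hΩ.kd_le_of_chain hz hiN fun k _ hk => hzi k (by omega)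
    push_cast at h3
    linarith
  have hspread : ∀ i < j, |(i : ℝ) - m| * h - 1 ≤ 2 * kd Ω (z i) o := by
    intro i hi
    have h0 : |(i : ℝ) - m| * h - 1 ≤ kd Ω (z i) (z m) := by
      rcases le_total i m with him | him
      · have : (i : ℝ) ≤ m := by exact_mod_cast him
        rw [abs_of_nonpos (by linarith), neg_sub]
        exact hmono i m him (by omega)
      · have : (m : ℝ) ≤ i := by exact_mod_cast him
        rw [abs_of_nonneg (by linarith), kd_comm]
        exact hmono m i him (by omega)
    have h1 := hΩ.kd_triangle (hz i) ho.1 (hz m)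
    have h2 := hmin i (Finset.mem_range.2 hi)
    rw [kd_comm o] at h1
    linarith
  have hlink : ∀ i ∈ Finset.range j, kd D (z i) (z (i + 1)) ≤
      h + 1 / a ^ 2 * (h / (1 + |(i : ℝ) - m| * h) ^ 2) := by
    intro i hi
    rw [Finset.mem_range] at hi
    have ht : 0 ≤ |(i : ℝ) - m| * h := by positivity
    set t := |(i : ℝ) - m| * h with htdef
    -- By `step2` the outside of `V` is far in proportion to `kd D (z i) o`; subtracting `h₀ ≥ h`
    -- leaves room for the link itself.
    set R := max h₀ ((kd D (z i) o - C) / A - h₀) with hR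
    have hRpos : 0 < R := hh₀pos.trans_le (le_max_left _ _)
    have hfar' : ∀ w ∈ Ω, w ∉ V → R + h ≤ kd Ω (z i) w := by
      intro w hw hwV
      rw [← le_sub_iff_add_le]
      refine max_le ?_ ?_
      · linarith [hfar _ (hz i) (by linarith [hja i hi]) w hw hwV]
      · have h1 := hAC _ (hz i) (hja i hi) w hw (by linarith [hnotV w hwV])
        have h2 : (kd D (z i) o - C) / A ≤ kd Ω (z i) w := by
          rw [div_le_iff₀ hA]; linarith
        linarith
    have h1 := hΩ.kd_inter_le (s := h) (R := R + h) (V := V) (by linarith) (hz i) (hz (i + 1))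
      hfar' (hzi i (by omega))
    rw [add_sub_cancel_right] at h1
    have h2 : a * (1 + t) ≤ R := by
      refine hlow t R (le_max_left _ _) (le_trans ?_ (le_max_right _ _))
      have h3 := hspread i hi
      have h4 := hD.kd_anti (Ω := Ω) inter_subset_left (hzD i hi.le) ho
      have h5 : (t - 1) / (2 * A) ≤ kd D (z i) o / A := by
        rw [div_le_div_iff₀ (by positivity) hA]
        nlinarith
      have h6 : 1 / (2 * A) * t - (1 / (2 * A) + C / A + h₀) =
          (t - 1) / (2 * A) - C / A - h₀ := by ring
      have h7 := sub_div (kd D (z i) o) C A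
      linarith
    have h3 : 1 / R ^ 2 ≤ 1 / (a * (1 + t)) ^ 2 := by
      gcongr
    have h4 := one_div_tanh_le hRpos
    calc kd D (z i) (z (i + 1)) ≤ h * (1 / Real.tanh R) := by rw [mul_one_div]; exact h1
      _ ≤ h * (1 + 1 / (a * (1 + t)) ^ 2) := by gcongr; linarith
      _ = _ := by field_simp
  -- The quadratic errors sum to a constant independent of the chain, so the local distance up to
  -- the exit is controlled with only an additive loss.
  have hsum : kd D (z 0) (z j) ≤ j * h + 4 / a ^ 2 := by
    refine (hD.kd_le_sum j hzD).trans ((Finset.sum_le_sum hlink).trans ?_)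
    rw [Finset.sum_add_distrib, ← Finset.mul_sum, Finset.sum_const, Finset.card_range, nsmul_eq_mul]
    have h1 := sum_div_sq_le hh hh2 m j
    have h2 : 1 / a ^ 2 * ∑ i ∈ Finset.range j, h / (1 + |(i : ℝ) - m| * h) ^ 2 ≤
        1 / a ^ 2 * 4 := by gcongr
    have h3 : 1 / a ^ 2 * 4 = 4 / a ^ 2 := by ring
    linarith
  have h1 := hC' _ (hz 0) _ (hz j) hxp.le hj (by linarith)
  have h2 := hΩ.kd_le_of_chain hz hjN fun k _ hk => hzi k hk
  have h3 := hΩ.kd_triangle (hz N) (hz j) ho.1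
  have h4 := hD.kd_anti (Ω := Ω) inter_subset_left (hzD 0 (by omega)) ho
  have h5 := hD.kd_anti (Ω := Ω) inter_subset_left (hzD j le_rfl) ho
  rw [kd_comm (z N) (z j)] at h3
  linarith

end

/-! ### From local visibility to global completeness and visibility. -/

section

variable {d : ℕ} {Ω : Set (EuclideanSpace ℂ (Fin d))}

/-- Consequences of local visibility at a boundary point for the global Kobayashi distance, at
arbitrarily small scales. -/
theorem IsLocallyVisible.exists_estimates (hΩ : IsBoundedDomain Ω) (hvis : IsLocallyVisible Ω)
    {p : EuclideanSpace ℂ (Fin d)} (hp : p ∈ frontier Ω) {r : ℝ} (hr : 0 < r) :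
    ∃ ρ > 0, 3 * ρ ≤ r ∧
      (∀ M : ℝ, ∀ᶠ x in 𝓝 p, x ∈ Ω → ∀ y ∈ Ω, 3 * ρ ≤ dist y p → M ≤ kd Ω x y) ∧
      ∃ o ∈ Ω, ∃ C : ℝ, ∀ x ∈ Ω, dist x p < ρ → ∀ y ∈ Ω, 2 * ρ ≤ dist y p →
        kd Ω x o + kd Ω y o ≤ kd Ω x y + C := by
  obtain ⟨V, hVo, hpV, hconn, hc, V', hV'o, hpV', hV', hv⟩ := hvis p hp
  have hD : IsBoundedDomain (Ω ∩ V) := ⟨hΩ.isOpen.inter hVo, hconn.isPreconnected,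
    hΩ.isBounded.subset inter_subset_left⟩
  obtain ⟨o, ho⟩ := hconn.nonempty
  obtain ⟨s, hs, hsV'⟩ := Metric.nhds_basis_closedBall.mem_iff.1 (hV'o.mem_nhds hpV')
  have hρ : 0 < min s r / 4 := by positivity
  set ρ := min s r / 4 with hρdef
  have hρs : 4 * ρ ≤ s := by linarith [min_le_left s r]
  have hρr : 4 * ρ ≤ r := by linarith [min_le_right s r]
  have hball : closedBall p (4 * ρ) ⊆ V' := (closedBall_subset_closedBall hρs).trans hsV'
  obtain ⟨⟨A, hA, C, hAC⟩, C', hC'⟩ := exists_local_estimates hΩ hD ho hρ (hball.trans hV')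
    fun ra rb hab har => exists_uniform_gromov_product_bound hΩ hD hc hV' hv ho hball hab har
  refine ⟨ρ, hρ, by linarith, fun M => ?_, o, ho.1, C', hC'⟩
  set M' := max (A * M + C) 0 with hM'
  -- Balls of the local metric are compact in `Ω ∩ V`, so they avoid a neighbourhood of `p`: the
  -- local distance to `o` blows up at `p`, and `hAC` passes this on to `K_Ω`.
  have hK := (hc.hopfRinow hD.isOpen hD.isBounded).1 o ho M' (le_max_right _ _)
  have hpK : p ∉ {z | z ∈ Ω ∩ V ∧ kobDist (Ω ∩ V) o z ≤ ENNReal.ofReal M'} := fun h =>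
    (hΩ.isOpen.frontier_eq ▸ hp).2 h.1.1
  filter_upwards [hK.isClosed.isOpen_compl.mem_nhds hpK, ball_mem_nhds p (by positivity : 0 < 2 * ρ),
    hVo.mem_nhds hpV] with x hx hxp hxV hxΩ y hy hyp
  have h1 : M' < kd (Ω ∩ V) o x := by
    refine lt_of_not_ge fun h => hx ⟨⟨hxΩ, hxV⟩, ?_⟩
    rw [← hD.ofReal_kd ho ⟨hxΩ, hxV⟩]
    exact ENNReal.ofReal_le_ofReal h
  have h2 := hAC x hxΩ hxp y hy hyp
  rw [kd_comm] at h1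
  have h3 : A * M ≤ A * kd Ω x y := by linarith [le_max_left (A * M + C) 0]
  exact le_of_mul_le_mul_left h3 hA

/-- The Kobayashi distance blows up at the boundary. -/
theorem IsLocallyVisible.eventually_le_kd (hΩ : IsBoundedDomain Ω) (hvis : IsLocallyVisible Ω)
    {p o : EuclideanSpace ℂ (Fin d)} (hp : p ∈ frontier Ω) (ho : o ∈ Ω) (M : ℝ) :
    ∀ᶠ x in 𝓝 p, x ∈ Ω → M ≤ kd Ω x o := by
  have hne : o ≠ p := fun h => (hΩ.isOpen.frontier_eq ▸ hp).2 (h ▸ ho)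
  obtain ⟨ρ, -, hρ, h, -⟩ := hvis.exists_estimates hΩ hp (dist_pos.2 hne)
  filter_upwards [h M] with x hx hxΩ
  exact hx hxΩ o ho hρ

/-- Gromov products of points near a boundary point with points away from it are bounded. -/
theorem IsLocallyVisible.exists_gromov_product_bound (hΩ : IsBoundedDomain Ω)
    (hvis : IsLocallyVisible Ω) {p o : EuclideanSpace ℂ (Fin d)} (hp : p ∈ frontier Ω)
    (ho : o ∈ Ω) {r : ℝ} (hr : 0 < r) :
    ∃ ε > 0, ∃ C : ℝ, ∀ x ∈ Ω, dist x p < ε → ∀ y ∈ Ω, r ≤ dist y p →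
      kd Ω x o + kd Ω y o ≤ kd Ω x y + C := by
  obtain ⟨ρ, hρ, hρr, -, o', ho', C, hC⟩ := hvis.exists_estimates hΩ hp hr
  refine ⟨ρ, hρ, C + 2 * kd Ω o' o, fun x hx hxp y hy hyp => ?_⟩
  have h1 := hC x hx hxp y hy (by linarith)
  have h2 := hΩ.kd_triangle hx ho' ho
  have h3 := hΩ.kd_triangle hy ho' ho
  linarith

/-- Blow-up at the boundary excludes limit points of the ball on `frontier Ω`. -/
theorem IsLocallyVisible.isCompact_setOf_kd_le (hΩ : IsBoundedDomain Ω)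
    (hvis : IsLocallyVisible Ω) {o : EuclideanSpace ℂ (Fin d)} (ho : o ∈ Ω) (M : ℝ) :
    IsCompact {z | z ∈ Ω ∧ kd Ω o z ≤ M} := by
  refine isCompact_of_isClosed_isBounded ?_ (hΩ.isBounded.subset fun z hz => hz.1)
  refine isClosed_of_closure_subset fun z hz => ?_
  have hfreq := mem_closure_iff_frequently.1 hz
  have hzΩ : z ∈ Ω := by
    by_contra hzΩ
    have hzf : z ∈ frontier Ω := by
      rw [hΩ.isOpen.frontier_eq]
      exact ⟨closure_mono (fun w hw => hw.1) hz, hzΩ⟩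
    obtain ⟨w, hw, hw'⟩ := (hfreq.and_eventually (hvis.eventually_le_kd hΩ hzf ho (M + 1))).exists
    have := hw' hw.1
    rw [kd_comm] at this
    linarith [hw.2]
  refine ⟨hzΩ, le_of_not_gt fun h => ?_⟩
  have hcont := (hΩ.continuousOn_kd ho).continuousAt (hΩ.isOpen.mem_nhds hzΩ)
  obtain ⟨w, hw, hw'⟩ := (hfreq.and_eventually (hcont.eventually_const_lt h)).exists
  exact hw'.not_ge hw.2

/-- A `K_Ω`-Cauchy sequence is Euclidean Cauchy; a limit on the boundary would contradict blow-up.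
-/
theorem IsLocallyVisible.isCompleteHyperbolic (hΩ : IsBoundedDomain Ω)
    (hvis : IsLocallyVisible Ω) : IsCompleteHyperbolic Ω := by
  obtain ⟨c, hc, hcd⟩ := hΩ.exists_mul_dist_le_kd
  refine ⟨fun x hx y hy => hΩ.kobDist_ne_top hx hy, fun x hx y hy h => ?_, fun u hu hcau => ?_⟩
  · have h1 := hcd x hx y hy
    rw [kd, h, ENNReal.toReal_zero] at h1
    exact dist_le_zero.1 (nonpos_of_mul_nonpos_right h1 hc)
  · have hcau' : ∀ ε > 0, ∃ N, ∀ m ≥ N, ∀ n ≥ N, kd Ω (u m) (u n) < ε := fun ε hε => by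
      obtain ⟨N, hN⟩ := hcau (ENNReal.ofReal ε) (ENNReal.ofReal_pos.2 hε)
      refine ⟨N, fun m hm n hn => ?_⟩
      have := hN m hm n hn
      rwa [← hΩ.ofReal_kd (hu m) (hu n), ENNReal.ofReal_lt_ofReal_iff hε] at this
    have hE : CauchySeq u := by
      rw [Metric.cauchySeq_iff]
      intro ε hε
      obtain ⟨N, hN⟩ := hcau' (c * ε) (by positivity)
      exact ⟨N, fun m hm n hn => lt_of_mul_lt_mul_left
        ((hcd _ (hu m) _ (hu n)).trans_lt (hN m hm n hn)) hc.le⟩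
    obtain ⟨p, hp⟩ := cauchySeq_tendsto_of_complete hE
    have hpΩ : p ∈ Ω := by
      by_contra hpΩ
      have hpf : p ∈ frontier Ω := by
        rw [hΩ.isOpen.frontier_eq]
        exact ⟨mem_closure_of_tendsto hp (Eventually.of_forall hu), hpΩ⟩
      obtain ⟨N, hN⟩ := hcau' 1 one_pos
      obtain ⟨n, hn, hn'⟩ := ((hp.eventually (hvis.eventually_le_kd hΩ hpf (hu N) 1)).and
        (eventually_ge_atTop N)).exists
      exact (hN n hn' N le_rfl).not_ge (hn (hu n))
    refine ⟨p, hpΩ, ((tendsto_kobDist_nhds hΩ.isOpen hpΩ).comp hp).congr fun n => ?_⟩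
    exact kobDist_comm _ _

/-- A geodesic from near `p` to near `q` has a point `z` away from both. Adding the Gromov product
bounds for `(x, z)` and `(y, z)` and using additivity along the geodesic gives `2 * kd Ω z o ≤ C₁ +
C₂`. -/
theorem IsLocallyVisible.isVisible (hΩ : IsBoundedDomain Ω) (hvis : IsLocallyVisible Ω)
    (hne : Ω.Nonempty) : IsVisible Ω := by
  intro p hp q hq hpq
  obtain ⟨o, ho⟩ := hne
  have hr : 0 < dist p q / 2 := half_pos (dist_pos.2 hpq)
  set r := dist p q / 2 with hrdef
  obtain ⟨ε₁, hε₁, C₁, h₁⟩ := hvis.exists_gromov_product_bound hΩ hp ho hr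
  obtain ⟨ε₂, hε₂, C₂, h₂⟩ := hvis.exists_gromov_product_bound hΩ hq ho hr
  refine ⟨ball p (min ε₁ r), ball_mem_nhds _ (by positivity), ball q (min ε₂ r),
    ball_mem_nhds _ (by positivity), {z | z ∈ Ω ∧ kd Ω o z ≤ (C₁ + C₂) / 2}, fun z hz => hz.1,
    hvis.isCompact_setOf_kd_le hΩ ho _, ball_disjoint_ball ?_, ?_⟩
  · linarith [min_le_right ε₁ r, min_le_right ε₂ r]
  rintro x ⟨hx, hxp⟩ y ⟨hy, hyq⟩ S hS
  rw [mem_ball, lt_min_iff] at hxp hyq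
  -- Geodesics are Lipschitz for the Euclidean metric, so the intermediate value theorem finds a
  -- crossing of the sphere of radius `r` about `p`.
  obtain ⟨z, hzS, hz, hzp⟩ : ∃ z ∈ S, z ∈ Ω ∧ dist z p = r := by
    obtain ⟨L, γ, hL, rfl, rfl, hγ, hiso, rfl⟩ := hS
    obtain ⟨c, hc, hcd⟩ := hΩ.exists_mul_dist_le_kd
    have hcont : ContinuousOn γ (Icc 0 L) := by
      refine LipschitzOnWith.continuousOn (K := (1 / c).toNNReal)
        (LipschitzOnWith.of_dist_le_mul fun s hs t ht => ?_)
      have h := hcd _ (hγ s hs) _ (hγ t ht)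
      rw [kd, hiso s hs t ht, ENNReal.toReal_ofReal (abs_nonneg _)] at h
      rw [Real.coe_toNNReal _ (by positivity), Real.dist_eq, one_div, ← div_eq_inv_mul,
        le_div_iff₀ hc, mul_comm]
      exact h
    have hdist : ContinuousOn (fun t => dist (γ t) p) (Icc 0 L) :=
      (continuous_id.dist continuous_const).comp_continuousOn hcont
    obtain ⟨t, ht, htr⟩ := intermediate_value_Icc hL hdist (show r ∈ Icc _ _ from
      ⟨hxp.2.le, by linarith [dist_triangle p (γ L) q, dist_comm p (γ L)]⟩)
    exact ⟨γ t, mem_image_of_mem _ ht, hγ t ht, htr⟩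
  refine ⟨z, hzS, hz, ?_⟩
  have hzq : r ≤ dist z q := by linarith [dist_triangle p z q, dist_comm p z]
  have e1 := h₁ x hx hxp.1 z hz hzp.ge
  have e2 := h₂ y hy hyq.1 z hz hzq
  have e3 := hS.kd_eq_add hzS
  have e4 := hΩ.kd_triangle hx ho hy
  rw [kd_comm o z]
  rw [kd_comm o y] at e4
  rw [kd_comm y z] at e2
  linarith

end

end Kobayashi

theorem corollary2p7 (d : ℕ) (Ω : Set (EuclideanSpace ℂ (Fin d)))
    (hopen : IsOpen Ω) (hconn : IsConnected Ω) (hbdd : Bornology.IsBounded Ω)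
    (hgromov : Kobayashi.IsLocallyGromovHyperbolic Ω) (hvis : Kobayashi.IsLocallyVisible Ω) :
    Kobayashi.IsCompleteHyperbolic Ω ∧ Kobayashi.IsVisible Ω := by
  have hΩ : Kobayashi.IsBoundedDomain Ω := ⟨hopen, hconn.isPreconnected, hbdd⟩
  exact ⟨hvis.isCompleteHyperbolic hΩ, hvis.isVisible hΩ hconn.nonempty⟩
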